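/- **Conventions.** A partition satisfies the *level 3 gap condition* if successive parts differ by at least $2$, and two parts differ by $2$ or $3$ only if their sum is a multiple of $3$. For a partition $\lambda$ let $|\lambda|$ be its size, $\nu_j(\lambda)$ the number of its parts congruent to $j$ modulo $3$, and $\psi_j(\lambda)=1$ if $j$ is a part of $\lambda$ and $\psi_j(\lambda)=0$ otherwise. Let $t,q\in\mathbb{C}$ with $t\neq 0$ and $|q|<1$, and put $$\mathcal{C}^{\alpha,\beta}(t;q):=\sum_{\lambda}\bigl(1-(1-\alpha)\psi_1(\lambda)\bigr)\bigl(1-(1-\beta)\psi_2(\lambda)\bigr)\,t^{\nu_1(\lambda)-\nu_2(\lambda)}q^{|\lambda|},$$ where $\lambda$ runs over all partitions (including the empty one) satisfying the level 3 gap condition. Let $\mathcal{C}_m(t;q):=\sum_\lambda t^{\nu_1(\lambda)-\nu_2(\lambda)}q^{|\lambda|}$ be the sum over those whose parts are all at least $m$, and $\mathcal{C}_2^*:=\mathcal{C}_1-\mathcal{C}_2+\mathcal{C}_3$. Let $(a;q)_\infty:=\prod_{j\ge 0}(1-aq^j)$, $\theta(z;q):=(-z;q)_\infty(-z^{-1}q;q)_\infty(q;q)_\infty$,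 and $$\Theta_1(t;q):=\sum_{k\ge 0}\chi_3(k)\,t^{-k}q^{k(k+1)},\qquad \Theta_2(t;q):=\sum_{k\ge 0}\chi_3(k)\,t^{k}q^{k^2},\qquad \chi_3(m):=\Bigl(\tfrac{m+1}{3}\Bigr)\ \text{(Legendre symbol)}.$$ At $q=0$ the theta factors below are read as their limits for $q\to 0$, all equal to $1$. **Theorem 3.1.** The series $\Theta_1(t;q)$ and $\Theta_2(t;q)$ converge absolutely, and for all $\alpha,\beta\in\{0,1\}$ the series $\mathcal{C}^{\alpha,\beta}(t;q)$ converges absolutely and $$\mathcal{C}^{\alpha,\beta}(t;q)=(\alpha+\beta-1)\,(-q^3;q^3)_\infty\,\theta(-t^2q^2;q^6)+\frac{\theta(tq^4;q^6)}{(q^3;q^3)_\infty}\bigl(\beta+(1-\alpha-\beta)\Theta_1(t;q)\bigr)+\frac{\theta(tq;q^6)}{(q^3;q^3)_\infty}\bigl(\alpha+(1-\alpha-\beta)\Theta_2(t;q)\bigr).$$ Moreover $\mathcal{C}_1=\mathcal{C}^{1,1}$, $\mathcal{C}_2=\mathcal{C}^{0,1}$, $\mathcal{C}_2^*=\mathcal{C}^{1,0}$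 and $\mathcal{C}_3=\mathcal{C}^{0,0}$, so that $$\mathcal{C}_2(t;q)=\frac{\theta(tq^4;q^6)}{(q^3;q^3)_\infty},\qquad \mathcal{C}_2^*(t;q)=\frac{\theta(tq;q^6)}{(q^3;q^3)_\infty},$$ $$\mathcal{C}_1(t;q)=(-q^3;q^3)_\infty\,\theta(-t^2q^2;q^6)+\mathcal{C}_2(t;q)\bigl(1-\Theta_1(t;q)\bigr)+\mathcal{C}_2^*(t;q)\bigl(1-\Theta_2(t;q)\bigr),$$ $$\mathcal{C}_3(t;q)=-(-q^3;q^3)_\infty\,\theta(-t^2q^2;q^6)+\mathcal{C}_2(t;q)\Theta_1(t;q)+\mathcal{C}_2^*(t;q)\Theta_2(t;q).$$ -/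

import Mathlib

namespace Capparelli

noncomputable section

/-- The infinite `q`-factorial `(a; q)_∞ = ∏_{j ≥ 0} (1 - a q ^ j)`. -/
def qFac (a q : ℂ) : ℂ := ∏' j : ℕ, (1 - a * q ^ j)

/-- The product defining `(a; q)_∞` converges for `‖q‖ < 1`. -/
theorem multipliable_qFac (a : ℂ) {q : ℂ} (hq : ‖q‖ < 1) :
    Multipliable (fun j : ℕ => 1 - a * q ^ j) := by
  have h : Summable (fun j : ℕ => ‖-(a * q ^ j)‖) := by
    simpa [norm_mul, norm_pow] using
      (summable_geometric_of_lt_one (norm_nonneg q) hq).mul_left ‖a‖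
  simpa [sub_eq_add_neg] using multipliable_one_add_of_summable h

/-- The denominator `(q; q)_∞` does not vanish for `‖q‖ < 1`. -/
theorem qFac_self_ne_zero {q : ℂ} (hq : ‖q‖ < 1) : qFac q q ≠ 0 := by
  have h : Summable (fun j : ℕ => ‖-(q * q ^ j)‖) := by
    simpa [norm_mul, norm_pow] using
      (summable_geometric_of_lt_one (norm_nonneg q) hq).mul_left ‖q‖
  have h1 : ∀ j : ℕ, 1 + -(q * q ^ j) ≠ 0 := by
    intro j hj
    have h2 : q ^ (j + 1) = 1 := by linear_combination -hj
    have h3 : ‖q‖ ^ (j + 1) = 1 := by rw [← norm_pow, h2, norm_one]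
    exact absurd h3 (pow_lt_one₀ (norm_nonneg q) hq (Nat.succ_ne_zero j)).ne
  simpa [qFac, sub_eq_add_neg] using tprod_one_add_ne_zero_of_summable h1 h

/-- The Jacobi theta function `θ(z; q) = (-z, -z⁻¹ q, q; q)_∞`. -/
def theta (z q : ℂ) : ℂ := qFac (-z) q * qFac (-z⁻¹ * q) q * qFac q q

/-- The shifted character `χ₃(m) = ((m + 1) / 3)` (Legendre symbol). -/
def chi3 (m : ℤ) : ℤ := legendreSym 3 (m + 1)

/-- The `k`-th term of `Θ₁(t; q)`. -/
def term1 (t q : ℂ) (k : ℕ) : ℂ := (chi3 k : ℂ) * t ^ (-(k : ℤ)) * q ^ (k * (k + 1))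

/-- The `k`-th term of `Θ₂(t; q)`. -/
def term2 (t q : ℂ) (k : ℕ) : ℂ := (chi3 k : ℂ) * t ^ k * q ^ (k ^ 2)

/-- The false theta function `Θ₁(t; q)`. -/
def Theta1 (t q : ℂ) : ℂ := ∑' k : ℕ, term1 t q k

/-- The false theta function `Θ₂(t; q)`. -/
def Theta2 (t q : ℂ) : ℂ := ∑' k : ℕ, term2 t q k

/-- The level `3` gap condition on the multiset of parts of a partition: successive parts (in
decreasing order) differ by at least `2`, and two parts differ by `2` or `3` only if their sum is
a multiple of `3`. -/
def Level3Gap (s : Multiset ℕ) : Prop :=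
  (s.sort (fun a b => b ≤ a)).IsChain (fun a b => b + 2 ≤ a) ∧
    ∀ a ∈ s, ∀ b ∈ s, (a = b + 2 ∨ a = b + 3) → 3 ∣ a + b

/-- Partitions (of all natural numbers `n`) that satisfy the level `3` gap condition. -/
abbrev GapPartition : Type := {lam : Σ n : ℕ, n.Partition // Level3Gap lam.2.parts}

/-- The multiset of parts. -/
def GapPartition.parts (lam : GapPartition) : Multiset ℕ := lam.1.2.parts

/-- The size `|λ|`. -/
def GapPartition.size (lam : GapPartition) : ℕ := lam.1.1

/-- The number `ν_j(λ)` of parts congruent to `j` modulo `3`. -/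
def nu (j : ℕ) (lam : GapPartition) : ℕ := lam.parts.countP (fun p => p ≡ j [MOD 3])

/-- The indicator `ψ_j(λ)` that `j` is a part. -/
def psi (j : ℕ) (lam : GapPartition) : ℂ := if j ∈ lam.parts then 1 else 0

/-- The monomial `t ^ (ν₁(λ) - ν₂(λ)) q ^ |λ|`. -/
def weight (t q : ℂ) (lam : GapPartition) : ℂ :=
  t ^ ((nu 1 lam : ℤ) - (nu 2 lam : ℤ)) * q ^ lam.size

/-- The summand of `C^{α,β}(t; q)`. -/
def termAB (α β t q : ℂ) (lam : GapPartition) : ℂ :=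
  (1 - (1 - α) * psi 1 lam) * (1 - (1 - β) * psi 2 lam) * weight t q lam

/-- The refined generating function `C^{α,β}(t; q)`. -/
def capAB (α β t q : ℂ) : ℂ := ∑' lam : GapPartition, termAB α β t q lam

/-- The refined generating function `C_m(t; q)`: all parts are at least `m`. -/
def cap (m : ℕ) (t q : ℂ) : ℂ :=
  ∑' lam : {lam : GapPartition // ∀ p ∈ lam.parts, m ≤ p}, weight t q lam.1

/-- The refined generating function `C₂^*(t; q) = C₁(t; q) - C₂(t; q) + C₃(t; q)`. -/
def capStar (t q : ℂ) : ℂ := cap 1 t q - cap 2 t q + cap 3 t q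

end

end Capparelli

open Capparelli

/-!
The sum over gap partitions is rewritten as a sum over finite sets of parts. Removing the smallest
part gives linear recurrences for the generating functions `gapSum t q m` of the gap partitions with
parts at least `m`. Since the recurrences are a summable perturbation of trivial ones, a solution is
determined by its limit for `m → ∞` (`GapRecurrence.unique`). A gauge transformation of the
recurrences (`GapRecurrence.shift`) then expresses the substitution `t ↦ t q ^ 3` within the space
spanned by `C₂`, `C₂^*` and `C₃`:
`C₂(t q ^ 3) = τ C₂^*(t)`, `C₂^*(t q ^ 3) = C₂(t)` and
`C₃(t q ^ 3) = τ ^ 2 C₃(t) + τ (1 - τ) C₂^*(t)`, where `τ = (t q)⁻¹`.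

For `q ≠ 0` all functions involved are sums of Laurent series in `t` on the punctured plane. A
Laurent series with `t ^ N f(t P) = C f(t)` is determined by `N` of its coefficients
(`HasLaurent.coeff_rec`), and in the cases needed here by its value at one point, or at the two
square roots of `q`. It is therefore enough to match the functional equations of the two sides of
each identity and to know the generating functions for `t ^ 2 = q`. There the recurrences have an
explicit solution by series of hypergeometric type (`gapRecurrence_gapTwo`): Euler's identity sums
`C₂ = C₂^*` to a product, and an identity of Rogers (`falseSum_zero`) gives `C₃ / C₂` as the false
theta function `∑ y ^ (n (3 n + 1) / 2) (1 - y ^ (2 n + 1))`, with `y = t ^ 3`.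

In this way one obtains the product formulas for `C₂` and `C₂^*` (`gapSum_two_eq`,
`gapSumStar_eq`), and two bilinear identities. With `F(t) = ∑ sgn(k) χ₃(k) t ^ k q ^ (k ^ 2)` and
`S(t) = ∑ χ₃(k) t ^ k q ^ (k ^ 2)`, the sums being over all integers and `sgn(0) = 1`, they are
`2 C₃(t) = C₂(t) F(q / t) + C₂^*(t) F(t)` (`two_mul_gapSum_three`) and
`2 (-q ^ 3; q ^ 3)_∞ θ(-t ^ 2 q ^ 2; q ^ 6) = C₂(t) S(q / t) + C₂^*(t) S(t)` (`two_mul_theta`).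
As `Θ₂(t) = (S(t) + F(t)) / 2` and `Θ₁(t) = Θ₂(q / t)`, their sum is the formula for `C₃`, and the
formula for `C₁` follows from the definition of `C₂^*`. For `q = 0` every series reduces to its
constant term.
-/

namespace Capparelli

open Filter Topology

/-! ### Gap partitions as finite sets -/

/-- The condition that the level `3` gap condition puts on two parts `a < b`. -/
def Compatible (a b : ℕ) : Prop := a + 2 ≤ b ∧ (b = a + 2 ∨ b = a + 3 → 3 ∣ a + b)

/-- The sets of parts of the gap partitions all of whose parts are at least `m`; a gap partition
has distinct parts, so that it is determined by its set of parts. -/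
def gapSets (m : ℕ) : Set (Finset ℕ) :=
  {S | (∀ a ∈ S, m ≤ a) ∧ ∀ a ∈ S, ∀ b ∈ S, a < b → Compatible a b}

/-- The contribution of a single part `p` to the weight of a partition. -/
noncomputable def partWeight (t q : ℂ) (p : ℕ) : ℂ :=
  (if p % 3 = 1 then t else if p % 3 = 2 then t⁻¹ else 1) * q ^ p

/-- The weight of a set of parts. -/
noncomputable def setWeight (t q : ℂ) (S : Finset ℕ) : ℂ := ∏ p ∈ S, partWeight t q p

/-- The generating function of the gap partitions with all parts at least `m`, as a sum over
sets. -/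
noncomputable def gapSum (t q : ℂ) (m : ℕ) : ℂ := ∑' S : gapSets m, setWeight t q S.1

theorem summable_norm_partWeight (t : ℂ) {q : ℂ} (hq : ‖q‖ < 1) :
    Summable fun p => ‖partWeight t q p‖ := by
  refine Summable.of_nonneg_of_le (fun _ => norm_nonneg _) (fun p => ?_)
    ((summable_geometric_of_lt_one (norm_nonneg q) hq).mul_left (‖t‖ + ‖t⁻¹‖ + 1))
  rw [partWeight, norm_mul, norm_pow]
  gcongr
  have h1 := norm_nonneg t
  have h2 := norm_nonneg t⁻¹
  split_ifs
  · linarith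
  · linarith
  · rw [norm_one]; linarith

theorem summable_norm_setWeight (t : ℂ) {q : ℂ} (hq : ‖q‖ < 1) :
    Summable fun S => ‖setWeight t q S‖ := by
  simpa [setWeight, norm_prod] using summable_finsetProd_of_summable_nonneg
    (fun _ => norm_nonneg _) (summable_norm_partWeight t hq)

theorem summable_setWeight (t : ℂ) {q : ℂ} (hq : ‖q‖ < 1) : Summable (setWeight t q) :=
  (summable_norm_setWeight t hq).of_norm

/-- The sum over the sets of `A`, split according to whether they contain `m`; the sets of `C` are
those that contain it, with `m` removed. -/
theorem tsum_setWeight_split {t q : ℂ} (hq : ‖q‖ < 1) {A B C : Set (Finset ℕ)} {m : ℕ}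
    (hA : A = B ∪ insert m '' C) (hB : ∀ S ∈ B, m ∉ S) (hC : ∀ S ∈ C, m ∉ S) :
    ∑' S : A, setWeight t q S.1 =
      ∑' S : B, setWeight t q S.1 + partWeight t q m * ∑' S : C, setWeight t q S.1 := by
  have hd : Disjoint B (insert m '' C) := by
    rw [Set.disjoint_left]
    rintro S hS ⟨T, -, rfl⟩
    exact hB _ hS (Finset.mem_insert_self m T)
  have hs := summable_setWeight t hq
  rw [hA, Summable.tsum_union_disjoint hd (hs.subtype _) (hs.subtype _)]
  congr 1
  have hinj : Set.InjOn (insert m : Finset ℕ → Finset ℕ) C := by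
    intro S hS T hT h
    rw [← Finset.erase_insert (hC S hS), h, Finset.erase_insert (hC T hT)]
  rw [tsum_image (setWeight t q) hinj, ← tsum_mul_left]
  exact tsum_congr fun S => by simp only [setWeight, Finset.prod_insert (hC S.1 S.2)]

theorem insert_mem_gapSets {m n : ℕ} {S : Finset ℕ} (hmn : m < n) (hS : S ∈ gapSets n)
    (h : ∀ b ∈ S, Compatible m b) : insert m S ∈ gapSets m := by
  refine ⟨fun a ha => ?_, fun a ha b hb hab => ?_⟩
  · rcases Finset.mem_insert.1 ha with rfl | ha
    · exact le_rfl
    · exact hmn.le.trans (hS.1 a ha)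
  · rcases Finset.mem_insert.1 ha with ha' | ha' <;> rcases Finset.mem_insert.1 hb with hb' | hb'
    · omega
    · exact ha' ▸ h b hb'
    · exact absurd (hS.1 a ha') (by omega)
    · exact hS.2 a ha' b hb' hab

theorem gapSets_anti {m n : ℕ} (h : m ≤ n) : gapSets n ⊆ gapSets m :=
  fun _ hS => ⟨fun a ha => h.trans (hS.1 a ha), hS.2⟩

theorem notMem_of_mem_gapSets {m n : ℕ} (h : m < n) {S : Finset ℕ} (hS : S ∈ gapSets n) :
    m ∉ S := fun hm => absurd (hS.1 m hm) (by omega)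

theorem erase_mem_gapSets {m n : ℕ} {S : Finset ℕ} (hS : S ∈ gapSets m) (hm : m ∈ S)
    (h : ∀ b, Compatible m b → n ≤ b) : S.erase m ∈ gapSets n := by
  refine ⟨fun a ha => ?_, fun a ha b hb => ?_⟩
  · have ha' := Finset.mem_erase.1 ha
    exact h a (hS.2 m hm a ha'.2 (lt_of_le_of_ne (hS.1 a ha'.2) ha'.1.symm))
  · exact hS.2 a (Finset.mem_of_mem_erase ha) b (Finset.mem_of_mem_erase hb)

/-- A gap set with parts at least `m`, not containing `m`, has parts at least `m + 1`. -/
theorem mem_gapSets_succ {m : ℕ} {S : Finset ℕ} (hS : S ∈ gapSets m) (hm : m ∉ S) :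
    S ∈ gapSets (m + 1) :=
  ⟨fun a ha => lt_of_le_of_ne (hS.1 a ha) (fun h => hm (h ▸ ha)), hS.2⟩

theorem gapSets_eq_union {m n : ℕ} (hmn : m < n) (h : ∀ b, Compatible m b ↔ n ≤ b) :
    gapSets m = gapSets (m + 1) ∪ insert m '' gapSets n := by
  ext S
  constructor
  · intro hS
    by_cases hm : m ∈ S
    · exact Or.inr ⟨S.erase m, erase_mem_gapSets hS hm fun b => (h b).1, Finset.insert_erase hm⟩
    · exact Or.inl (mem_gapSets_succ hS hm)
  · rintro (hS | ⟨T, hT, rfl⟩)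
    · exact gapSets_anti (Nat.le_succ m) hS
    · exact insert_mem_gapSets hmn hT fun b hb => (h b).2 (hT.1 b hb)

theorem gapSum_split {t q : ℂ} (hq : ‖q‖ < 1) {m n : ℕ} (hmn : m < n)
    (h : ∀ b, Compatible m b ↔ n ≤ b) :
    gapSum t q m = gapSum t q (m + 1) + partWeight t q m * gapSum t q n :=
  tsum_setWeight_split hq (gapSets_eq_union hmn h)
    (fun _ hS => notMem_of_mem_gapSets (Nat.lt_succ_self m) hS)
    (fun _ hS => notMem_of_mem_gapSets hmn hS)

/-- Removing the smallest part from a gap partition, for a smallest part `≡ 0 (mod 3)`. -/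
theorem gapSum_three_mul_add_three {t q : ℂ} (hq : ‖q‖ < 1) (k : ℕ) :
    gapSum t q (3 * k + 3) =
      gapSum t q (3 * k + 4) + q ^ (3 * k + 3) * gapSum t q (3 * k + 6) := by
  rw [gapSum_split hq (m := 3 * k + 3) (n := 3 * k + 6) (by omega)
    (by intro b; unfold Compatible; omega)]
  simp [partWeight, show (3 * k + 3) % 3 = 0 by omega]

/-- Removing the smallest part from a gap partition, for a smallest part `≡ 1 (mod 3)`. -/
theorem gapSum_three_mul_add_one {t q : ℂ} (hq : ‖q‖ < 1) (k : ℕ) :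
    gapSum t q (3 * k + 1) =
      gapSum t q (3 * k + 2) + t * q ^ (3 * k + 1) * gapSum t q (3 * k + 5) := by
  rw [gapSum_split hq (m := 3 * k + 1) (n := 3 * k + 5) (by omega)
    (by intro b; unfold Compatible; omega)]
  simp [partWeight, show (3 * k + 1) % 3 = 1 by omega]

/-- Removing the smallest part `m` from a gap partition, for `m ≡ 2 (mod 3)`; here the next part
may be `m + 2`, in which case it is removed too. -/
theorem gapSum_three_mul_add_two {t q : ℂ} (hq : ‖q‖ < 1) (k : ℕ) :
    gapSum t q (3 * k + 2) = gapSum t q (3 * k + 3) + t⁻¹ * q ^ (3 * k + 2) *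
      (gapSum t q (3 * k + 6) + t * q ^ (3 * k + 4) * gapSum t q (3 * k + 8)) := by
  have hA : gapSets (3 * k + 2) = gapSets (3 * k + 3) ∪
      insert (3 * k + 2) '' (gapSets (3 * k + 6) ∪ insert (3 * k + 4) '' gapSets (3 * k + 8)) := by
    ext S
    constructor
    · intro hS
      by_cases hm : 3 * k + 2 ∈ S
      · refine Or.inr ⟨S.erase (3 * k + 2), ?_, Finset.insert_erase hm⟩
        have hS' : S.erase (3 * k + 2) ∈ gapSets (3 * k + 4) :=
          erase_mem_gapSets hS hm (by intro b; unfold Compatible; omega)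
        by_cases hm' : 3 * k + 4 ∈ S.erase (3 * k + 2)
        · exact Or.inr ⟨_, erase_mem_gapSets hS' hm' (by intro b; unfold Compatible; omega),
            Finset.insert_erase hm'⟩
        · refine Or.inl ⟨fun a ha => ?_, hS'.2⟩
          have h1 := hS.2 _ hm a (Finset.mem_of_mem_erase ha)
          have h2 := hS'.1 a ha
          have h3 : a ≠ 3 * k + 4 := fun h => hm' (h ▸ ha)
          unfold Compatible at h1
          omega
      · exact Or.inl (mem_gapSets_succ hS hm)
    · rintro (hS | ⟨T, hT | ⟨U, hU, rfl⟩, rfl⟩)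
      · exact gapSets_anti (Nat.le_succ _) hS
      · refine insert_mem_gapSets (n := 3 * k + 6) (by omega) hT fun b hb => ?_
        have := hT.1 b hb
        unfold Compatible
        omega
      · have hU' : insert (3 * k + 4) U ∈ gapSets (3 * k + 4) := by
          refine insert_mem_gapSets (n := 3 * k + 8) (by omega) hU fun b hb => ?_
          have := hU.1 b hb
          unfold Compatible
          omega
        refine insert_mem_gapSets (n := 3 * k + 4) (by omega) hU' fun b hb => ?_
        rcases Finset.mem_insert.1 hb with rfl | hb
        · unfold Compatible
          omega
        · have := hU.1 b hb
          unfold Compatible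
          omega
  have hB : ∑' S : ↥(gapSets (3 * k + 6) ∪ insert (3 * k + 4) '' gapSets (3 * k + 8)),
      setWeight t q S.1 = _ :=
    tsum_setWeight_split hq rfl
      (fun _ hS => notMem_of_mem_gapSets (by omega) hS)
      (fun _ hS => notMem_of_mem_gapSets (by omega) hS)
  rw [gapSum, tsum_setWeight_split hq hA (fun _ hS => notMem_of_mem_gapSets (by omega) hS), hB]
  · simp [partWeight, gapSum, show (3 * k + 2) % 3 = 2 by omega,
      show (3 * k + 4) % 3 = 1 by omega]
  · rintro S (hS | ⟨T, hT, rfl⟩)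
    · exact notMem_of_mem_gapSets (by omega) hS
    · rw [Finset.mem_insert, not_or]
      exact ⟨by omega, notMem_of_mem_gapSets (by omega) hT⟩

/-- As `m` grows, only the empty partition survives. -/
theorem tendsto_gapSum (t : ℂ) {q : ℂ} (hq : ‖q‖ < 1) :
    Tendsto (gapSum t q) atTop (𝓝 1) := by
  classical
  have h1 : ∀ m, gapSum t q m = ∑' S, (gapSets m).indicator (setWeight t q) S :=
    fun m => tsum_subtype _ _
  have h2 : Tendsto (fun m => ∑' S, (gapSets m).indicator (setWeight t q) S) atTop
      (𝓝 (∑' S : Finset ℕ, if S = ∅ then 1 else 0)) := by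
    refine tendsto_tsum_of_dominated_convergence (summable_norm_setWeight t hq) (fun S => ?_)
      (Eventually.of_forall fun m S => norm_indicator_le_norm_self _ _)
    split_ifs with hS
    · subst hS
      refine tendsto_const_nhds.congr fun m => ?_
      rw [Set.indicator_of_mem (by simp [gapSets])]
      simp [setWeight]
    · obtain ⟨a, ha⟩ := Finset.nonempty_iff_ne_empty.2 hS
      refine tendsto_const_nhds.congr' ?_
      filter_upwards [eventually_gt_atTop a] with m hm
      exact (Set.indicator_of_notMem (fun h => notMem_of_mem_gapSets hm h ha) _).symm
  simpa [← h1, tsum_ite_eq] using h2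

/-! ### From partitions to sets of parts -/

theorem level3Gap_iff {s : Multiset ℕ} :
    Level3Gap s ↔ s.Nodup ∧ ∀ a ∈ s, ∀ b ∈ s, a < b → Compatible a b := by
  have htr : IsTrans ℕ (fun a b => b + 2 ≤ a) := ⟨fun a b c h1 h2 => by omega⟩
  have hsymm : Std.Symm (fun a b : ℕ => a + 2 ≤ b ∨ b + 2 ≤ a) := ⟨fun a b h => h.symm⟩
  have hsort : s.Nodup ↔ (s.sort (fun a b => b ≤ a)).Nodup := by
    conv_lhs => rw [← Multiset.sort_eq s (fun a b => b ≤ a)]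
    exact Multiset.coe_nodup
  have hpw : (s.sort (fun a b => b ≤ a)).Pairwise (fun a b => b ≤ a) :=
    Multiset.pairwise_sort s _
  unfold Level3Gap Compatible
  rw [List.isChain_iff_pairwise, hsort]
  constructor
  · rintro ⟨h1, h2⟩
    refine ⟨h1.imp (fun h => by omega), fun a ha b hb hab => ⟨?_, fun h => ?_⟩⟩
    · have h3 : (s.sort (fun a b => b ≤ a)).Pairwise (fun a b => a + 2 ≤ b ∨ b + 2 ≤ a) :=
        h1.imp Or.inr
      have := h3.forall ((Multiset.mem_sort _).2 ha) ((Multiset.mem_sort _).2 hb) hab.ne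
      omega
    · have := h2 b hb a ha h
      rwa [add_comm] at this
  · rintro ⟨h1, h2⟩
    refine ⟨?_, fun a ha b hb h => ?_⟩
    · refine (hpw.and h1).imp_of_mem fun {a b} ha hb h => ?_
      exact (h2 b ((Multiset.mem_sort _).1 hb) a ((Multiset.mem_sort _).1 ha)
        (lt_of_le_of_ne h.1 h.2.symm)).1
    · have := (h2 b hb a ha (by omega)).2 h
      rwa [add_comm] at this

theorem GapPartition.parts_injective : Function.Injective GapPartition.parts := by
  rintro ⟨⟨m, ⟨s, hs, rfl⟩⟩, h⟩ ⟨⟨n, ⟨s', hs', rfl⟩⟩, h'⟩ (rfl : s = s')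
  rfl

theorem GapPartition.parts_nodup (lam : GapPartition) : lam.parts.Nodup :=
  (level3Gap_iff.1 lam.2).1

theorem GapPartition.toFinset_mem (lam : GapPartition) : lam.parts.toFinset ∈ gapSets 1 := by
  refine ⟨fun a ha => ?_, fun a ha b hb => ?_⟩
  · exact lam.1.2.parts_pos (Multiset.mem_toFinset.1 ha)
  · exact (level3Gap_iff.1 lam.2).2 a (Multiset.mem_toFinset.1 ha) b (Multiset.mem_toFinset.1 hb)

theorem GapPartition.toFinset_bijective : Function.Bijective
    (fun lam : GapPartition => (⟨lam.parts.toFinset, lam.toFinset_mem⟩ : gapSets 1)) := by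
  constructor
  · intro lam mu h
    apply GapPartition.parts_injective
    have h1 : lam.parts.toFinset = mu.parts.toFinset := congrArg Subtype.val h
    have h2 := congrArg Finset.val h1
    rwa [Multiset.toFinset_val, Multiset.toFinset_val, lam.parts_nodup.dedup,
      mu.parts_nodup.dedup] at h2
  · rintro ⟨S, hS⟩
    refine ⟨⟨⟨S.val.sum, ⟨S.val, fun {a} ha => hS.1 a ha, rfl⟩⟩, level3Gap_iff.2 ⟨S.nodup, hS.2⟩⟩,
      Subtype.ext ?_⟩
    exact Finset.val_toFinset S

/-- A gap partition is the same thing as its set of parts. -/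
noncomputable def gapPartitionEquiv : GapPartition ≃ gapSets 1 :=
  Equiv.ofBijective _ GapPartition.toFinset_bijective

theorem mem_gapPartitionEquiv {lam : GapPartition} {a : ℕ} :
    a ∈ (gapPartitionEquiv lam).1 ↔ a ∈ lam.parts := Multiset.mem_toFinset

theorem prod_map_partWeight {t : ℂ} (ht : t ≠ 0) (q : ℂ) (s : Multiset ℕ) :
    (s.map (partWeight t q)).prod =
      t ^ ((s.countP (fun p => p ≡ 1 [MOD 3]) : ℤ) - (s.countP (fun p => p ≡ 2 [MOD 3]) : ℤ)) *
        q ^ s.sum := by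
  induction s using Multiset.induction_on with
  | empty => simp
  | cons a s ih =>
    rw [Multiset.map_cons, Multiset.prod_cons, ih, Multiset.sum_cons, Multiset.countP_cons,
      Multiset.countP_cons, partWeight, pow_add]
    have h3 : a % 3 = 0 ∨ a % 3 = 1 ∨ a % 3 = 2 := by omega
    rcases h3 with h | h | h
    · simp [Nat.ModEq, h]
      ring
    · simp only [Nat.ModEq, h, if_true, Nat.one_mod, Nat.reduceMod, OfNat.one_ne_ofNat, if_false,
        add_zero, Nat.cast_add, Nat.cast_one]
      rw [add_sub_right_comm, zpow_add_one₀ ht]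
      ring
    · simp only [Nat.ModEq, h, if_true, Nat.one_mod, Nat.reduceMod, OfNat.ofNat_ne_one, if_false,
        add_zero, Nat.cast_add, Nat.cast_one]
      rw [← sub_sub, zpow_sub_one₀ ht]
      ring

theorem weight_eq {t : ℂ} (ht : t ≠ 0) (q : ℂ) (lam : GapPartition) :
    weight t q lam = setWeight t q (gapPartitionEquiv lam).1 := by
  have h1 : setWeight t q (gapPartitionEquiv lam).1 = (lam.parts.map (partWeight t q)).prod := by
    change (lam.parts.dedup.map (partWeight t q)).prod = _
    rw [lam.parts_nodup.dedup]
  have h2 : lam.parts.sum = lam.size := lam.1.2.parts_sum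
  rw [h1, prod_map_partWeight ht, h2]
  rfl

theorem summable_norm_weight {t q : ℂ} (ht : t ≠ 0) (hq : ‖q‖ < 1) :
    Summable fun lam => ‖weight t q lam‖ := by
  have h := ((summable_norm_setWeight t hq).subtype (gapSets 1))
  have h2 := (gapPartitionEquiv.summable_iff).2 h
  exact h2.congr fun lam => by simp [weight_eq ht]

theorem cap_eq_tsum {t q : ℂ} (m : ℕ) :
    cap m t q = ∑' lam : GapPartition,
      {lam : GapPartition | ∀ p ∈ lam.parts, m ≤ p}.indicator (weight t q) lam :=
  tsum_subtype {lam : GapPartition | ∀ p ∈ lam.parts, m ≤ p} (weight t q)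

theorem cap_eq_gapSum {t q : ℂ} (ht : t ≠ 0) {m : ℕ} (hm : 1 ≤ m) :
    cap m t q = gapSum t q m := by
  rw [cap_eq_tsum, gapSum, tsum_subtype (gapSets m) (setWeight t q)]
  have h1 : ∑' S, (gapSets m).indicator (setWeight t q) S =
      ∑' S : gapSets 1, (gapSets m).indicator (setWeight t q) S.1 :=
    (tsum_subtype_eq_of_support_subset
      (Set.support_indicator_subset.trans (gapSets_anti hm))).symm
  rw [h1, ← gapPartitionEquiv.tsum_eq]
  refine tsum_congr fun lam => ?_
  by_cases h : ∀ p ∈ lam.parts, m ≤ p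
  · rw [Set.indicator_of_mem (by exact h), Set.indicator_of_mem, weight_eq ht]
    exact ⟨fun a ha => h a (mem_gapPartitionEquiv.1 ha), (gapPartitionEquiv lam).2.2⟩
  · rw [Set.indicator_of_notMem (by exact h), Set.indicator_of_notMem]
    exact fun hS => h fun p hp => hS.1 p (mem_gapPartitionEquiv.2 hp)

theorem summable_termAB {t q : ℂ} (ht : t ≠ 0) (hq : ‖q‖ < 1) {α β : ℂ}
    (hα : α ∈ ({0, 1} : Set ℂ)) (hβ : β ∈ ({0, 1} : Set ℂ)) : Summable (termAB α β t q) := by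
  have h1 : ∀ γ ∈ ({0, 1} : Set ℂ), ∀ j lam, ‖1 - (1 - γ) * psi j lam‖ ≤ 1 := by
    rintro γ (rfl | rfl) j lam <;> unfold psi <;> split_ifs <;> simp
  refine Summable.of_norm_bounded (summable_norm_weight ht hq) fun lam => ?_
  rw [termAB, norm_mul, norm_mul]
  exact mul_le_of_le_one_left (norm_nonneg _)
    (mul_le_one₀ (h1 α hα 1 lam) (norm_nonneg _) (h1 β hβ 2 lam))

theorem GapPartition.pos_of_mem {lam : GapPartition} {p : ℕ} (h : p ∈ lam.parts) : 1 ≤ p :=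
  lam.1.2.parts_pos h

theorem capAB_one_one (t q : ℂ) : capAB 1 1 t q = cap 1 t q := by
  rw [cap_eq_tsum]
  refine tsum_congr fun lam => ?_
  rw [Set.indicator_of_mem]
  · simp [termAB]
  · exact fun p hp => GapPartition.pos_of_mem hp

theorem capAB_zero_one (t q : ℂ) : capAB 0 1 t q = cap 2 t q := by
  rw [cap_eq_tsum]
  refine tsum_congr fun lam => ?_
  by_cases h : 1 ∈ lam.parts
  · rw [Set.indicator_of_notMem (by intro h2; exact absurd (h2 1 h) (by omega))]
    simp [termAB, psi, h]
  · rw [Set.indicator_of_mem]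
    · simp [termAB, psi, h]
    · intro p hp
      have h1 := GapPartition.pos_of_mem hp
      have h2 : p ≠ 1 := fun e => h (e ▸ hp)
      omega

theorem capAB_zero_zero (t q : ℂ) : capAB 0 0 t q = cap 3 t q := by
  rw [cap_eq_tsum]
  refine tsum_congr fun lam => ?_
  by_cases h : 1 ∈ lam.parts
  · rw [Set.indicator_of_notMem (by intro h2; exact absurd (h2 1 h) (by omega))]
    simp [termAB, psi, h]
  by_cases h' : 2 ∈ lam.parts
  · rw [Set.indicator_of_notMem (by intro h2; exact absurd (h2 2 h') (by omega))]
    simp [termAB, psi, h']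
  · rw [Set.indicator_of_mem]
    · simp [termAB, psi, h, h']
    · intro p hp
      have h1 := GapPartition.pos_of_mem hp
      have h2 : p ≠ 1 := fun e => h (e ▸ hp)
      have h3 : p ≠ 2 := fun e => h' (e ▸ hp)
      omega

/-- Since `1` and `2` are not both parts of a gap partition, `1 - ψ₂` is
`1 - (1 - ψ₁) + (1 - ψ₁) (1 - ψ₂)`. -/
theorem capAB_one_zero {t q : ℂ} (ht : t ≠ 0) (hq : ‖q‖ < 1) :
    capAB 1 0 t q = capStar t q := by
  have h0 : (0 : ℂ) ∈ ({0, 1} : Set ℂ) := by simp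
  have h1 : (1 : ℂ) ∈ ({0, 1} : Set ℂ) := by simp
  have s11 := summable_termAB ht hq h1 h1
  have s01 := summable_termAB ht hq h0 h1
  have s00 := summable_termAB ht hq h0 h0
  rw [capStar, ← capAB_one_one, ← capAB_zero_one, ← capAB_zero_zero, capAB, capAB, capAB, capAB,
    ← s11.tsum_sub s01, ← (s11.sub s01).tsum_add s00]
  refine tsum_congr fun lam => ?_
  have h12 : psi 1 lam * psi 2 lam = 0 := by
    by_cases h : 1 ∈ lam.parts <;> by_cases h' : 2 ∈ lam.parts
    · have := (level3Gap_iff.1 lam.2).2 1 h 2 h' (by omega)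
      exact absurd this.1 (by omega)
    all_goals simp [psi, h, h']
  rw [termAB, termAB, termAB, termAB]
  linear_combination (- weight t q lam) * h12

/-! ### The recurrences and their uniqueness -/

/-- The linear recurrences satisfied by the generating functions `b k` and `d k` of the gap
partitions with parts at least `3 k + 2` and `3 k + 3`, where `p = q ^ 3`, `s = t q` and
`σ = t⁻¹ q ^ 2`. -/
def GapRecurrence (s σ p : ℂ) (b d : ℕ → ℂ) : Prop :=
  (∀ k, b k = d k + σ * p ^ k * d (k + 1) + p ^ (2 * k + 2) * b (k + 2)) ∧
    ∀ k, d k = b (k + 1) + s * p ^ (k + 1) * b (k + 2) + p ^ (k + 1) * d (k + 1)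

theorem gapRecurrence_gapSum {t q : ℂ} (ht : t ≠ 0) (hq : ‖q‖ < 1) :
    GapRecurrence (t * q) (t⁻¹ * q ^ 2) (q ^ 3) (fun k => gapSum t q (3 * k + 2))
      (fun k => gapSum t q (3 * k + 3)) := by
  constructor <;> intro k
  · have h := gapSum_three_mul_add_two (t := t) hq k
    have e1 : 3 * (k + 1) + 3 = 3 * k + 6 := by ring
    have e2 : 3 * (k + 2) + 2 = 3 * k + 8 := by ring
    simp only [e1, e2]
    rw [h]
    have : t⁻¹ * t = 1 := inv_mul_cancel₀ ht
    linear_combination q ^ (3 * k + 2) * q ^ (3 * k + 4) * gapSum t q (3 * k + 8) * this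
  · have h := gapSum_three_mul_add_three (t := t) hq k
    have h' := gapSum_three_mul_add_one (t := t) hq (k + 1)
    have e1 : 3 * (k + 1) + 3 = 3 * k + 6 := by ring
    have e2 : 3 * (k + 2) + 2 = 3 * k + 8 := by ring
    have e3 : 3 * (k + 1) + 1 = 3 * k + 4 := by ring
    have e4 : 3 * (k + 1) + 5 = 3 * k + 8 := by ring
    simp only [e1, e2, e3, e4] at h' ⊢
    rw [h, h']
    ring

theorem GapRecurrence.sub {s σ p : ℂ} {b d b' d' : ℕ → ℂ} (h : GapRecurrence s σ p b d)
    (h' : GapRecurrence s σ p b' d') :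
    GapRecurrence s σ p (fun k => b k - b' k) (fun k => d k - d' k) := by
  constructor <;> intro k
  · linear_combination h.1 k - h'.1 k
  · linear_combination h.2 k - h'.2 k

/-- A solution of the recurrences that is small from some index on is small everywhere, since the
recurrences are a summable perturbation of `b k = d k = b (k + 1)`. -/
theorem GapRecurrence.norm_le {s σ p : ℂ} (hp : ‖p‖ < 1) {b d : ℕ → ℂ}
    (h : GapRecurrence s σ p b d) {ε : ℝ} (hε : 0 ≤ ε) {N : ℕ}
    (hN : ∀ j, N ≤ j → ‖b j‖ ≤ ε ∧ ‖d j‖ ≤ ε) (n : ℕ) :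
    ∀ j, N ≤ j + n →
      ‖b j‖ ≤ ε * Real.exp (2 * (‖s‖ + ‖σ‖ + 1) / (1 - ‖p‖) * ‖p‖ ^ j) ∧
        ‖d j‖ ≤ ε * Real.exp (2 * (‖s‖ + ‖σ‖ + 1) / (1 - ‖p‖) * ‖p‖ ^ j) := by
  set ρ := ‖p‖ with hρ
  set K := ‖s‖ + ‖σ‖ + 1 with hK
  have hρ0 : 0 ≤ ρ := norm_nonneg p
  have hs0 := norm_nonneg s
  have hσ0 := norm_nonneg σ
  have hK0 : 0 < K := by positivity
  have h1ρ : 0 < 1 - ρ := by linarith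
  have hc0 : 0 ≤ 2 * K / (1 - ρ) := by positivity
  induction n with
  | zero =>
    intro j hj
    have h1 : ε ≤ ε * Real.exp (2 * K / (1 - ρ) * ρ ^ j) :=
      le_mul_of_one_le_right hε (Real.one_le_exp (by positivity))
    exact ⟨(hN j hj).1.trans h1, (hN j hj).2.trans h1⟩
  | succ n ih =>
    intro j hj
    have hj1 := ih (j + 1) (by omega)
    have hj2 := ih (j + 2) (by omega)
    set M := ε * Real.exp (2 * K / (1 - ρ) * ρ ^ (j + 1)) with hM
    have hM0 : 0 ≤ M := by positivity
    have hmono : ε * Real.exp (2 * K / (1 - ρ) * ρ ^ (j + 2)) ≤ M := by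
      have : ρ ^ (j + 2) ≤ ρ ^ (j + 1) := pow_le_pow_of_le_one hρ0 hp.le (by omega)
      rw [hM]
      gcongr
    have hb2 := hj2.1.trans hmono
    have hx1 : ρ ^ (j + 1) ≤ ρ ^ j := pow_le_pow_of_le_one hρ0 hp.le (by omega)
    have hx2 : ρ ^ (2 * j + 2) ≤ ρ ^ j := pow_le_pow_of_le_one hρ0 hp.le (by omega)
    have hx0 : 0 ≤ ρ ^ j := by positivity
    have hd : ‖d j‖ ≤ (1 + K * ρ ^ j) * M := by
      rw [h.2 j]
      calc ‖b (j + 1) + s * p ^ (j + 1) * b (j + 2) + p ^ (j + 1) * d (j + 1)‖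
          ≤ ‖b (j + 1)‖ + ‖s‖ * ρ ^ (j + 1) * ‖b (j + 2)‖ + ρ ^ (j + 1) * ‖d (j + 1)‖ := by
            refine (norm_add₃_le).trans ?_
            simp [norm_pow, hρ]
        _ ≤ M + ‖s‖ * ρ ^ j * M + ρ ^ j * M := by
            gcongr
            · exact hj1.1
            · exact hj1.2
        _ ≤ (1 + K * ρ ^ j) * M := by
            rw [hK]
            nlinarith [mul_nonneg (mul_nonneg hσ0 hx0) hM0]
    have hb : ‖b j‖ ≤ (1 + 2 * K * ρ ^ j) * M := by
      rw [h.1 j]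
      calc ‖d j + σ * p ^ j * d (j + 1) + p ^ (2 * j + 2) * b (j + 2)‖
          ≤ ‖d j‖ + ‖σ‖ * ρ ^ j * ‖d (j + 1)‖ + ρ ^ (2 * j + 2) * ‖b (j + 2)‖ := by
            refine (norm_add₃_le).trans ?_
            simp [norm_pow, hρ]
        _ ≤ (1 + K * ρ ^ j) * M + ‖σ‖ * ρ ^ j * M + ρ ^ j * M := by
            gcongr
            exact hj1.2
        _ ≤ (1 + 2 * K * ρ ^ j) * M := by
            rw [hK]
            nlinarith [mul_nonneg (mul_nonneg hs0 hx0) hM0]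
    have hexp : (1 + 2 * K * ρ ^ j) * M ≤ ε * Real.exp (2 * K / (1 - ρ) * ρ ^ j) := by
      have e : 2 * K / (1 - ρ) * ρ ^ j = 2 * K * ρ ^ j + 2 * K / (1 - ρ) * ρ ^ (j + 1) := by
        field_simp
        ring
      rw [e, Real.exp_add, hM, mul_left_comm]
      gcongr
      rw [add_comm]
      exact Real.add_one_le_exp _
    refine ⟨hb.trans hexp, hd.trans (le_trans ?_ hexp)⟩
    gcongr
    nlinarith

theorem GapRecurrence.eq_zero {s σ p : ℂ} (hp : ‖p‖ < 1) {b d : ℕ → ℂ}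
    (h : GapRecurrence s σ p b d) (hb : Tendsto b atTop (𝓝 0)) (hd : Tendsto d atTop (𝓝 0))
    (k : ℕ) : b k = 0 ∧ d k = 0 := by
  set R := Real.exp (2 * (‖s‖ + ‖σ‖ + 1) / (1 - ‖p‖) * ‖p‖ ^ k) with hR
  have hR0 : 0 < R := Real.exp_pos _
  have key : ∀ ε > 0, ‖b k‖ ≤ ε ∧ ‖d k‖ ≤ ε := by
    intro ε hε
    have hε' : 0 < ε / R := by positivity
    have e1 := (tendsto_zero_iff_norm_tendsto_zero.1 hb).eventually_le_const hε'
    have e2 := (tendsto_zero_iff_norm_tendsto_zero.1 hd).eventually_le_const hε'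
    obtain ⟨N, hN⟩ := eventually_atTop.1 (e1.and e2)
    have := h.norm_le hp hε'.le hN N k (by omega)
    rwa [← hR, div_mul_cancel₀ _ hR0.ne'] at this
  constructor
  · exact norm_le_zero_iff.1 (le_of_forall_pos_le_add fun ε hε => by simpa using (key ε hε).1)
  · exact norm_le_zero_iff.1 (le_of_forall_pos_le_add fun ε hε => by simpa using (key ε hε).2)

/-- The recurrences determine a solution by its limit. -/
theorem GapRecurrence.unique {s σ p l : ℂ} (hp : ‖p‖ < 1) {b d b' d' : ℕ → ℂ}
    (h : GapRecurrence s σ p b d) (h' : GapRecurrence s σ p b' d')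
    (hb : Tendsto b atTop (𝓝 l)) (hd : Tendsto d atTop (𝓝 l))
    (hb' : Tendsto b' atTop (𝓝 l)) (hd' : Tendsto d' atTop (𝓝 l)) (k : ℕ) :
    b k = b' k ∧ d k = d' k := by
  have := (h.sub h').eq_zero hp (by simpa using hb.sub hb') (by simpa using hd.sub hd') k
  exact ⟨sub_eq_zero.1 this.1, sub_eq_zero.1 this.2⟩

/-- A gauge transformation: if `s τ = 1`, then a solution for the parameters `(s, τ p)` gives one
for `(s p, τ)`. For the generating functions this is the substitution `t ↦ t q ^ 3`. -/
theorem GapRecurrence.shift {s τ p : ℂ} (hsτ : s * τ = 1) {b d : ℕ → ℂ}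
    (h : GapRecurrence s (τ * p) p b d) :
    GapRecurrence (s * p) τ p (fun k => τ * d k + (1 - τ + τ * p ^ k) * b (k + 1))
      (fun k => b k - p ^ (k + 1) * d (k + 1) -
        (s * p ^ (k + 1) - p ^ (k + 1) + p ^ (2 * k + 2)) * b (k + 2)) := by
  constructor <;> intro k
  · linear_combination -(h.1 k) - (1 - τ) * h.2 k +
      (p ^ (2 * k + 2) * b (k + 3) + p ^ (k + 1) * b (k + 2)) * hsτ
  · linear_combination h.1 k + h.2 k + (1 - p ^ (k + 1)) * h.1 (k + 1) +
      (1 - p ^ (k + 1)) * (1 - τ) * h.2 (k + 1) +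
      (-p ^ (k + 2) * d (k + 2) + p ^ (k + 2) * b (k + 3) - p ^ (2 * k + 4) * b (k + 3) -
        (1 - p ^ (k + 1)) * p ^ (k + 2) * b (k + 3)) * hsτ

theorem tendsto_gapSum_arith (t : ℂ) {q : ℂ} (hq : ‖q‖ < 1) (j : ℕ) :
    Tendsto (fun k => gapSum t q (3 * k + j)) atTop (𝓝 1) :=
  (tendsto_gapSum t hq).comp
    (tendsto_atTop_mono (fun k : ℕ => show k ≤ 3 * k + j by omega) tendsto_id)

theorem norm_pow_lt_one {q : ℂ} (hq : ‖q‖ < 1) {n : ℕ} (hn : n ≠ 0) : ‖q ^ n‖ < 1 := by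
  rw [norm_pow]
  exact pow_lt_one₀ (norm_nonneg q) hq hn

theorem norm_pow_three_lt_one {q : ℂ} (hq : ‖q‖ < 1) : ‖q ^ 3‖ < 1 :=
  norm_pow_lt_one hq three_ne_zero

/-- The substitution `t ↦ t q ^ 3` in the generating functions: by `GapRecurrence.shift` both sides
solve the same recurrences, and both tend to `1`. -/
theorem gapSum_shift {t q : ℂ} (ht : t ≠ 0) (hq0 : q ≠ 0) (hq : ‖q‖ < 1) (k : ℕ) :
    gapSum (t * q ^ 3) q (3 * k + 2) = (t * q)⁻¹ * gapSum t q (3 * k + 3) +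
        (1 - (t * q)⁻¹ + (t * q)⁻¹ * (q ^ 3) ^ k) * gapSum t q (3 * (k + 1) + 2) ∧
      gapSum (t * q ^ 3) q (3 * k + 3) = gapSum t q (3 * k + 2) -
        (q ^ 3) ^ (k + 1) * gapSum t q (3 * (k + 1) + 3) -
        (t * q * (q ^ 3) ^ (k + 1) - (q ^ 3) ^ (k + 1) + (q ^ 3) ^ (2 * k + 2)) *
          gapSum t q (3 * (k + 2) + 2) := by
  have hp := norm_pow_three_lt_one hq
  have e1 : t⁻¹ * q ^ 2 = (t * q)⁻¹ * q ^ 3 := by field_simp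
  have e2 : t * q ^ 3 * q = t * q * q ^ 3 := by ring
  have e3 : (t * q ^ 3)⁻¹ * q ^ 2 = (t * q)⁻¹ := by field_simp
  have h := gapRecurrence_gapSum ht hq
  rw [e1] at h
  have h1 := h.shift (mul_inv_cancel₀ (mul_ne_zero ht hq0))
  have h2 := gapRecurrence_gapSum (mul_ne_zero ht (pow_ne_zero 3 hq0)) hq
  rw [e2, e3] at h2
  have hx : Tendsto (fun k : ℕ => (q ^ 3) ^ k) atTop (𝓝 0) :=
    tendsto_pow_atTop_nhds_zero_of_norm_lt_one hp
  have hx1 := hx.comp (tendsto_add_atTop_nat 1)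
  have hx2 := hx.comp (tendsto_atTop_mono (fun k : ℕ => show k ≤ 2 * k + 2 by omega) tendsto_id)
  have hb := tendsto_gapSum_arith t hq 2
  have hd := tendsto_gapSum_arith t hq 3
  have hb1 := hb.comp (tendsto_add_atTop_nat 1)
  have hd1 := hd.comp (tendsto_add_atTop_nat 1)
  have hb2 := hb.comp (tendsto_add_atTop_nat 2)
  refine h2.unique hp h1 (tendsto_gapSum_arith _ hq 2) (tendsto_gapSum_arith _ hq 3) ?_ ?_ k
  · have := (hd.const_mul (t * q)⁻¹).add
      (((hx.const_mul (t * q)⁻¹).const_add (1 - (t * q)⁻¹)).mul hb1)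
    simpa using this
  · have := (hb.sub (hx1.mul hd1)).sub
      ((((hx1.const_mul (t * q)).sub hx1).add hx2).mul hb2)
    simpa using this

/-- The generating function `C₂^*`, in terms of the other ones: it counts the partitions with
parts at least `3`, and those containing `1`. -/
noncomputable def gapSumStar (t q : ℂ) : ℂ := gapSum t q 3 + t * q * gapSum t q 5

theorem capStar_eq {t q : ℂ} (ht : t ≠ 0) (hq : ‖q‖ < 1) : capStar t q = gapSumStar t q := by
  rw [capStar, cap_eq_gapSum ht le_rfl, cap_eq_gapSum ht (by norm_num),
    cap_eq_gapSum ht (by norm_num), gapSumStar]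
  have := gapSum_three_mul_add_one (t := t) hq 0
  simp only [mul_zero, zero_add, pow_one] at this
  rw [this]
  ring

theorem gapSum_two_shift {t q : ℂ} (ht : t ≠ 0) (hq0 : q ≠ 0) (hq : ‖q‖ < 1) :
    gapSum (t * q ^ 3) q 2 = (t * q)⁻¹ * gapSumStar t q := by
  have h := (gapSum_shift ht hq0 hq 0).1
  norm_num at h
  rw [h, gapSumStar]
  field_simp

theorem gapSum_three_shift {t q : ℂ} (ht : t ≠ 0) (hq0 : q ≠ 0) (hq : ‖q‖ < 1) :
    gapSum (t * q ^ 3) q 3 =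
      (t * q)⁻¹ ^ 2 * gapSum t q 3 + (t * q)⁻¹ * (1 - (t * q)⁻¹) * gapSumStar t q := by
  have h := (gapSum_shift ht hq0 hq 0).2
  have h2 := (gapRecurrence_gapSum ht hq).1 0
  have h3 := (gapRecurrence_gapSum ht hq).2 0
  norm_num at h h2 h3
  have e : t * q * (t * q)⁻¹ = 1 := mul_inv_cancel₀ (mul_ne_zero ht hq0)
  have e' : t⁻¹ * q ^ 2 = (t * q)⁻¹ * q ^ 3 := by field_simp
  rw [e'] at h2
  rw [h, gapSumStar]
  linear_combination h2 + (1 - (t * q)⁻¹) * h3 +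
    (- q ^ 3 * gapSum t q 8 - (1 - (t * q)⁻¹) * gapSum t q 5) * e

theorem gapSumStar_shift {t q : ℂ} (ht : t ≠ 0) (hq0 : q ≠ 0) (hq : ‖q‖ < 1) :
    gapSumStar (t * q ^ 3) q = gapSum t q 2 := by
  have h := (gapSum_shift ht hq0 hq 0).2
  have h' := (gapSum_shift ht hq0 hq 1).1
  norm_num at h h'
  have e : t * q * (q⁻¹ * t⁻¹) = 1 := by field_simp
  rw [gapSumStar, h, h']
  linear_combination (q ^ 3 * gapSum t q 6 - q ^ 3 * gapSum t q 8 + q ^ 6 * gapSum t q 8) * e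

/-! ### Infinite `q`-factorials -/

theorem qFac_eq_mul (a : ℂ) {q : ℂ} (hq : ‖q‖ < 1) :
    qFac a q = (1 - a) * qFac (a * q) q := by
  have h2 : ∀ j : ℕ, 1 - a * q * q ^ j = 1 - a * q ^ (j + 1) := fun j => by rw [pow_succ']; ring
  have h : Multipliable (fun j : ℕ => 1 - a * q ^ (j + 1)) :=
    (multipliable_congr h2).1 (multipliable_qFac (a * q) hq)
  have h3 : ∏' j : ℕ, (1 - a * q ^ j) = (1 - a * q ^ 0) * ∏' j : ℕ, (1 - a * q ^ (j + 1)) :=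
    tprod_eq_zero_mul' (f := fun j : ℕ => 1 - a * q ^ j) h
  unfold qFac
  rw [tprod_congr h2, h3, pow_zero, mul_one]

theorem qFac_eq_prod_mul (a : ℂ) {q : ℂ} (hq : ‖q‖ < 1) (n : ℕ) :
    qFac a q = (∏ i ∈ Finset.range n, (1 - a * q ^ i)) * qFac (a * q ^ n) q := by
  induction n with
  | zero => simp
  | succ n ih => rw [ih, Finset.prod_range_succ, qFac_eq_mul (a * q ^ n) hq]; ring_nf

theorem qFac_ne_zero {a q : ℂ} (hq : ‖q‖ < 1) (h : ∀ j : ℕ, a * q ^ j ≠ 1) : qFac a q ≠ 0 := by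
  have hs : Summable (fun j : ℕ => ‖-(a * q ^ j)‖) := by
    simpa [norm_mul, norm_pow] using
      (summable_geometric_of_lt_one (norm_nonneg q) hq).mul_left ‖a‖
  have h1 : ∀ j : ℕ, 1 + -(a * q ^ j) ≠ 0 := fun j hj => h j (by linear_combination -hj)
  simpa [qFac, sub_eq_add_neg] using tprod_one_add_ne_zero_of_summable h1 hs

theorem mul_pow_ne_one {a q : ℂ} (ha : ‖a‖ < 1) (hq : ‖q‖ < 1) (j : ℕ) : a * q ^ j ≠ 1 := by
  intro h
  have h1 : ‖a * q ^ j‖ < 1 := by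
    rw [norm_mul, norm_pow]
    exact (mul_le_of_le_one_right (norm_nonneg _) (pow_le_one₀ (norm_nonneg _) hq.le)).trans_lt ha
  rw [h, norm_one] at h1
  exact lt_irrefl _ h1

theorem qFac_ne_zero_of_norm_lt {a q : ℂ} (ha : ‖a‖ < 1) (hq : ‖q‖ < 1) : qFac a q ≠ 0 :=
  qFac_ne_zero hq (mul_pow_ne_one ha hq)

theorem tendsto_qFac_mul_pow (a : ℂ) {q : ℂ} (hq : ‖q‖ < 1) :
    Tendsto (fun k : ℕ => qFac (a * q ^ k) q) atTop (𝓝 1) := by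
  have h := tendsto_tprod_one_add_of_dominated_convergence (𝓕 := atTop)
    (f := fun k j : ℕ => -(a * q ^ k * q ^ j)) (g := fun _ => 0)
    (bound := fun j => ‖a‖ * ‖q‖ ^ j)
    ((summable_geometric_of_lt_one (norm_nonneg q) hq).mul_left ‖a‖) (fun j => ?_)
    (Eventually.of_forall fun k j => ?_)
  · simpa [qFac, sub_eq_add_neg] using h
  · have h1 := tendsto_pow_atTop_nhds_zero_of_norm_lt_one hq
    simpa using ((h1.const_mul a).mul_const (q ^ j)).neg
  · rw [norm_neg, norm_mul, norm_mul, norm_pow, norm_pow]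
    gcongr
    exact mul_le_of_le_one_right (norm_nonneg _) (pow_le_one₀ (norm_nonneg _) hq.le)

theorem exists_bound_qFac_mul_pow (a : ℂ) {q : ℂ} (hq : ‖q‖ < 1) :
    ∃ M : ℝ, ∀ k : ℕ, ‖qFac (a * q ^ k) q‖ ≤ M := by
  obtain ⟨M, hM⟩ := (tendsto_qFac_mul_pow a hq).norm.bddAbove_range
  exact ⟨M, fun k => hM ⟨k, rfl⟩⟩

/-! ### Sums of hypergeometric type -/

theorem summable_prod_range {X : ℕ → ℝ} (h0 : ∀ i, 0 ≤ X i) (hX : Tendsto X atTop (𝓝 0)) :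
    Summable fun m => ∏ i ∈ Finset.range m, X i := by
  refine summable_of_ratio_norm_eventually_le (r := 1 / 2) (by norm_num) ?_
  filter_upwards [hX.eventually_le_const (show (0 : ℝ) < 1 / 2 by norm_num)] with m hm
  rw [Finset.prod_range_succ, norm_mul, mul_comm, Real.norm_of_nonneg (h0 m)]
  gcongr

theorem norm_prod_range_mul_le {X : ℕ → ℝ} {x u : ℕ → ℂ} (hx : ∀ i, ‖x i‖ ≤ X i) {M : ℝ}
    (hu : ∀ m, ‖u m‖ ≤ M) (m : ℕ) :
    ‖(∏ i ∈ Finset.range m, x i) * u m‖ ≤ (∏ i ∈ Finset.range m, X i) * M := by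
  rw [norm_mul, norm_prod]
  have h0 : ∀ i, 0 ≤ X i := fun i => (norm_nonneg _).trans (hx i)
  exact mul_le_mul (Finset.prod_le_prod (fun i _ => norm_nonneg _) fun i _ => hx i) (hu m)
    (norm_nonneg _) (Finset.prod_nonneg fun i _ => h0 i)

theorem summable_prod_range_mul {X : ℕ → ℝ} (hX : Tendsto X atTop (𝓝 0)) {x u : ℕ → ℂ}
    (hx : ∀ i, ‖x i‖ ≤ X i) {M : ℝ} (hu : ∀ m, ‖u m‖ ≤ M) :
    Summable fun m => (∏ i ∈ Finset.range m, x i) * u m :=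
  Summable.of_norm_bounded
    ((summable_prod_range (fun i => (norm_nonneg _).trans (hx i)) hX).mul_right M)
    (norm_prod_range_mul_le hx hu)

theorem tendsto_tsum_prod_range_mul {X : ℕ → ℝ} (hX : Tendsto X atTop (𝓝 0))
    {x u : ℕ → ℕ → ℂ} (hx : ∀ k i, ‖x k i‖ ≤ X i)
    (hx0 : Tendsto (fun k => x k 0) atTop (𝓝 0)) {M : ℝ} (hu : ∀ k m, ‖u k m‖ ≤ M)
    (hu0 : Tendsto (fun k => u k 0) atTop (𝓝 1)) :
    Tendsto (fun k => ∑' m, (∏ i ∈ Finset.range m, x k i) * u k m) atTop (𝓝 1) := by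
  have h0 : ∀ i, 0 ≤ X i := fun i => (norm_nonneg _).trans (hx 0 i)
  have hM : 0 ≤ M := (norm_nonneg _).trans (hu 0 0)
  have h := tendsto_tsum_of_dominated_convergence (𝓕 := atTop)
    (f := fun k m => (∏ i ∈ Finset.range m, x k i) * u k m)
    (g := fun m : ℕ => if m = 0 then (1 : ℂ) else 0)
    ((summable_prod_range h0 hX).mul_right M) (fun m => ?_)
    (Eventually.of_forall fun k => norm_prod_range_mul_le (hx k) (hu k))
  · simpa using h
  · rcases m with _ | m
    · simpa using hu0
    · rw [if_neg (Nat.succ_ne_zero m)]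
      refine squeeze_zero_norm (a := fun k =>
        ((∏ i ∈ Finset.range m, X (i + 1)) * M) * ‖x k 0‖) (fun k => ?_) ?_
      · rw [Finset.prod_range_succ', mul_right_comm, norm_mul]
        gcongr
        rw [norm_mul, norm_prod]
        exact mul_le_mul (Finset.prod_le_prod (fun i _ => norm_nonneg _) fun i _ => hx k _)
          (hu k _) (norm_nonneg _) (Finset.prod_nonneg fun i _ => h0 _)
      · simpa using hx0.norm.const_mul ((∏ i ∈ Finset.range m, X (i + 1)) * M)

/-- If `a n = c n * a (n + 1)` with `c` and `a` tending to zero, then `‖a‖` is eventually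
increasing, so that `a` vanishes. -/
theorem eq_zero_of_eq_mul_succ {a c : ℕ → ℂ} (h : ∀ n, a n = c n * a (n + 1))
    (hc : Tendsto c atTop (𝓝 0)) (ha : Tendsto a atTop (𝓝 0)) (n : ℕ) : a n = 0 := by
  obtain ⟨N, hN⟩ := eventually_atTop.1
    ((tendsto_zero_iff_norm_tendsto_zero.1 hc).eventually_le_const (show (0 : ℝ) < 1 by norm_num))
  have h1 : ∀ m, N ≤ m → a m = 0 := by
    intro m hm
    have h2 : ∀ j, ‖a m‖ ≤ ‖a (m + j)‖ := by
      intro j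
      induction j with
      | zero => exact le_rfl
      | succ j ih =>
        refine ih.trans ?_
        rw [h (m + j), norm_mul]
        exact mul_le_of_le_one_left (norm_nonneg _) (hN _ (by omega))
    have h3 : Tendsto (fun j => ‖a (m + j)‖) atTop (𝓝 0) :=
      (tendsto_zero_iff_norm_tendsto_zero.1 ha).comp
        (tendsto_atTop_mono (fun j : ℕ => show j ≤ m + j by omega) tendsto_id)
    exact norm_le_zero_iff.1 (ge_of_tendsto' h3 h2)
  have h4 : ∀ j m, N ≤ m + j → a m = 0 := by
    intro j
    induction j with
    | zero => exact h1
    | succ j ih => exact fun m hm => by rw [h m, ih (m + 1) (by omega), mul_zero]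
  exact h4 N n (by omega)

theorem one_sub_pow_succ_ne_zero {p : ℂ} (hp : ‖p‖ < 1) (i : ℕ) : 1 - p ^ (i + 1) ≠ 0 := by
  intro h
  have h1 : ‖p‖ ^ (i + 1) = 1 := by rw [← norm_pow, ← sub_eq_zero.1 h, norm_one]
  exact absurd h1 (pow_lt_one₀ (norm_nonneg p) hp (Nat.succ_ne_zero i)).ne

theorem norm_inv_one_add_le {z : ℂ} {r : ℝ} (hz : ‖z‖ ≤ r) (hr : r < 1) :
    ‖(1 + z)⁻¹‖ ≤ (1 - r)⁻¹ := by
  rw [norm_inv]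
  have h1 : 1 - ‖z‖ ≤ ‖1 + z‖ := by
    have := norm_sub_norm_le (1 : ℂ) (-z)
    rwa [norm_one, norm_neg, sub_neg_eq_add] at this
  exact inv_anti₀ (by linarith) (by linarith)

theorem norm_inv_one_sub_pow_le {p : ℂ} (hp : ‖p‖ < 1) (i : ℕ) :
    ‖(1 - p ^ (i + 1))⁻¹‖ ≤ (1 - ‖p‖)⁻¹ := by
  rw [sub_eq_add_neg]
  refine norm_inv_one_add_le ?_ hp
  rw [norm_neg, norm_pow, pow_succ]
  exact mul_le_of_le_one_left (norm_nonneg _) (pow_le_one₀ (norm_nonneg _) hp.le)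

theorem tendsto_mul_pow_mul {ρ : ℝ} (h0 : 0 ≤ ρ) (h1 : ρ < 1) (a b : ℝ) :
    Tendsto (fun i : ℕ => a * ρ ^ i * b) atTop (𝓝 0) := by
  simpa using ((tendsto_pow_atTop_nhds_zero_of_lt_one h0 h1).const_mul a).mul_const b

/-- **Euler's identity** `∑ p ^ (m (m - 1) / 2) c ^ m / (p; p)_m = (-c; p)_∞`. -/
theorem tsum_prod_eq_qFac (c : ℂ) {p : ℂ} (hp : ‖p‖ < 1) :
    ∑' m, ∏ i ∈ Finset.range m, c * p ^ i / (1 - p ^ (i + 1)) = qFac (-c) p := by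
  set X : ℕ → ℝ := fun i => ‖c‖ * ‖p‖ ^ i * (1 - ‖p‖)⁻¹ with hX
  have hX0 : Tendsto X atTop (𝓝 0) := tendsto_mul_pow_mul (norm_nonneg p) hp _ _
  have hpk : ∀ k : ℕ, ‖p‖ ^ k ≤ 1 := fun k => pow_le_one₀ (norm_nonneg _) hp.le
  have hbd : ∀ k i : ℕ, ‖c * p ^ k * p ^ i / (1 - p ^ (i + 1))‖ ≤ X i := by
    intro k i
    rw [div_eq_mul_inv, norm_mul, norm_mul, norm_mul, norm_pow, norm_pow]
    have := norm_inv_one_sub_pow_le hp i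
    have h2 : ‖c‖ * ‖p‖ ^ k ≤ ‖c‖ := mul_le_of_le_one_right (norm_nonneg _) (hpk k)
    simp only [hX]
    gcongr
  have hone : ∀ m : ℕ, ‖(1 : ℂ)‖ ≤ 1 := fun _ => by simp
  set e : ℕ → ℂ := fun k => ∑' m, ∏ i ∈ Finset.range m, c * p ^ k * p ^ i / (1 - p ^ (i + 1))
    with he
  have hsum : ∀ k, Summable fun m =>
      ∏ i ∈ Finset.range m, c * p ^ k * p ^ i / (1 - p ^ (i + 1)) := fun k => by
    simpa using summable_prod_range_mul hX0 (hbd k) hone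
  have hrec : ∀ k, e k = (1 + c * p ^ k) * e (k + 1) := by
    intro k
    have hP : ∀ m, ∏ i ∈ Finset.range m, c * p ^ (k + 1) * p ^ i / (1 - p ^ (i + 1)) =
        p ^ m * ∏ i ∈ Finset.range m, c * p ^ k * p ^ i / (1 - p ^ (i + 1)) := by
      intro m
      rw [← Finset.card_range m, ← Finset.prod_const, Finset.card_range,
        ← Finset.prod_mul_distrib]
      exact Finset.prod_congr rfl fun i _ => by ring
    have h1 : e k - e (k + 1) = c * p ^ k * e (k + 1) := by
      simp only [he]
      rw [← (hsum k).tsum_sub (hsum (k + 1)), ← tsum_mul_left,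
        ((hsum k).sub (hsum (k + 1))).tsum_eq_zero_add]
      simp only [Finset.range_zero, Finset.prod_empty, sub_self, zero_add]
      refine tsum_congr fun m => ?_
      rw [hP, hP, Finset.prod_range_succ]
      have := one_sub_pow_succ_ne_zero hp m
      field_simp
    linear_combination h1
  have hlim : Tendsto e atTop (𝓝 1) := by
    have h := tendsto_tsum_prod_range_mul hX0 hbd (u := fun _ _ => 1) (M := 1) ?_
      (fun _ => hone) tendsto_const_nhds
    · simpa [he] using h
    · have := tendsto_pow_atTop_nhds_zero_of_norm_lt_one hp
      simpa [div_eq_mul_inv] using ((this.const_mul c).mul_const 1).mul_const (1 - p)⁻¹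
  have hfin : ∀ n, e 0 = (∏ i ∈ Finset.range n, (1 - (-c) * p ^ i)) * e n := by
    intro n
    induction n with
    | zero => simp
    | succ n ih => rw [ih, hrec n, Finset.prod_range_succ]; ring
  have h1 : Tendsto (fun n => (∏ i ∈ Finset.range n, (1 - (-c) * p ^ i)) * e n) atTop
      (𝓝 (qFac (-c) p * 1)) :=
    (multipliable_qFac (-c) hp).hasProd.tendsto_prod_nat.mul hlim
  have h2 := tendsto_nhds_unique (tendsto_const_nhds.congr hfin) h1
  simpa [he] using h2

/-! ### The generating functions at `t ^ 2 = q` -/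

/-- The quotient `p ^ (k m + m (m + 1) / 2) (-y; p)_m / (p; p)_m`. -/
noncomputable def gapCoeff (y p : ℂ) (k m : ℕ) : ℂ :=
  ∏ i ∈ Finset.range m, p ^ (k + i + 1) * (1 + y * p ^ i) / (1 - p ^ (i + 1))

/-- A closed form of the generating function of the gap partitions with parts at least `3 k + 2`,
for `t ^ 2 = q`, `y = t ^ 3` and `p = q ^ 3`. -/
noncomputable def gapTwo (y p : ℂ) (k : ℕ) : ℂ :=
  ∑' m, gapCoeff y p k m * qFac (-y * p ^ (m + k)) p

/-- A closed form of the generating function of the gap partitions with parts at least `3 k + 3`,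
for `t ^ 2 = q`, `y = t ^ 3` and `p = q ^ 3`. -/
noncomputable def gapThree (y p : ℂ) (k : ℕ) : ℂ :=
  ∑' m, gapCoeff y p k m * qFac (-y * p ^ (m + k + 1)) p

section
variable {y p : ℂ}

theorem norm_gapCoeff_factor_le (hy : ‖y‖ < 1) (hp : ‖p‖ < 1) (k i : ℕ) :
    ‖p ^ (k + i + 1) * (1 + y * p ^ i) / (1 - p ^ (i + 1))‖ ≤
      1 * ‖p‖ ^ i * (2 * (1 - ‖p‖)⁻¹) := by
  have h1 := norm_inv_one_sub_pow_le hp i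
  have h2 : ‖1 + y * p ^ i‖ ≤ 2 := by
    refine (norm_add_le _ _).trans ?_
    rw [norm_one, norm_mul, norm_pow]
    have : ‖y‖ * ‖p‖ ^ i ≤ 1 := mul_le_one₀ hy.le (by positivity)
      (pow_le_one₀ (norm_nonneg _) hp.le)
    linarith
  have h3 : ‖p‖ ^ (k + i + 1) ≤ ‖p‖ ^ i :=
    pow_le_pow_of_le_one (norm_nonneg _) hp.le (by omega)
  rw [div_eq_mul_inv, norm_mul, norm_mul, norm_pow, one_mul, mul_assoc]
  gcongr

theorem summable_gapCoeff_mul (hy : ‖y‖ < 1) (hp : ‖p‖ < 1) (k : ℕ) {u : ℕ → ℂ} {M : ℝ}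
    (hu : ∀ m, ‖u m‖ ≤ M) : Summable fun m => gapCoeff y p k m * u m :=
  summable_prod_range_mul (tendsto_mul_pow_mul (norm_nonneg p) hp _ _)
    (norm_gapCoeff_factor_le hy hp k) hu

theorem gapCoeff_succ_left (k m : ℕ) : gapCoeff y p (k + 1) m = p ^ m * gapCoeff y p k m := by
  unfold gapCoeff
  rw [← Finset.card_range m, ← Finset.prod_const, Finset.card_range, ← Finset.prod_mul_distrib]
  exact Finset.prod_congr rfl fun i _ => by ring

theorem gapCoeff_succ_right (hp : ‖p‖ < 1) (k m : ℕ) :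
    gapCoeff y p k (m + 1) * (1 - p ^ (m + 1)) =
      gapCoeff y p k m * (p ^ (k + m + 1) * (1 + y * p ^ m)) := by
  have := one_sub_pow_succ_ne_zero hp m
  rw [gapCoeff, Finset.prod_range_succ, ← gapCoeff]
  field_simp

theorem summable_gapTwo (hy : ‖y‖ < 1) (hp : ‖p‖ < 1) (k j : ℕ) :
    Summable fun m => gapCoeff y p k m * qFac (-y * p ^ (m + j)) p := by
  obtain ⟨M, hM⟩ := exists_bound_qFac_mul_pow (-y) hp
  exact summable_gapCoeff_mul hy hp k fun m => hM _

theorem gapTwo_sub (hy : ‖y‖ < 1) (hp : ‖p‖ < 1) (k : ℕ) :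
    gapTwo y p k - y * p ^ k * gapTwo y p (k + 1) = gapThree y p k := by
  rw [gapTwo, gapTwo, gapThree, ← tsum_mul_left,
    ← (summable_gapTwo hy hp k k).tsum_sub ((summable_gapTwo hy hp (k + 1) (k + 1)).mul_left _)]
  refine tsum_congr fun m => ?_
  rw [gapCoeff_succ_left, qFac_eq_mul (-y * p ^ (m + k)) hp, ← add_assoc]
  ring_nf

theorem gapThree_sub (hy : ‖y‖ < 1) (hp : ‖p‖ < 1) (k : ℕ) :
    gapThree y p k - p ^ (k + 1) * gapThree y p (k + 1) =
      gapTwo y p (k + 1) + y * p ^ (k + 1) * gapTwo y p (k + 2) := by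
  have s0 := summable_gapTwo hy hp k (k + 1)
  have s1 := summable_gapTwo hy hp (k + 1) (k + 2)
  have s2 := summable_gapTwo hy hp (k + 1) (k + 1)
  have s3 := summable_gapTwo hy hp (k + 2) (k + 2)
  have h : gapThree y p k - gapTwo y p (k + 1) =
      p ^ (k + 1) * gapThree y p (k + 1) + y * p ^ (k + 1) * gapTwo y p (k + 2) := by
    change ∑' m, gapCoeff y p k m * qFac (-y * p ^ (m + (k + 1))) p -
        ∑' m, gapCoeff y p (k + 1) m * qFac (-y * p ^ (m + (k + 1))) p =
      p ^ (k + 1) * ∑' m, gapCoeff y p (k + 1) m * qFac (-y * p ^ (m + (k + 2))) p +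
        y * p ^ (k + 1) * ∑' m, gapCoeff y p (k + 2) m * qFac (-y * p ^ (m + (k + 2))) p
    rw [← s0.tsum_sub s2, ← tsum_mul_left, ← tsum_mul_left,
      ← (s1.mul_left _).tsum_add (s3.mul_left _), (s0.sub s2).tsum_eq_zero_add]
    have h0 : gapCoeff y p k 0 = 1 ∧ gapCoeff y p (k + 1) 0 = 1 := by simp [gapCoeff]
    rw [h0.1, h0.2, sub_self, zero_add]
    refine tsum_congr fun m => ?_
    have h1 := gapCoeff_succ_right (y := y) hp k m
    have e : m + 1 + (k + 1) = m + (k + 2) := by ring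
    rw [gapCoeff_succ_left k (m + 1), gapCoeff_succ_left (k + 1) m, gapCoeff_succ_left k m, e]
    linear_combination qFac (-y * p ^ (m + (k + 2))) p * h1
  linear_combination h

/-- At `t ^ 2 = q` both parameters of the recurrences are `y = t ^ 3`, which makes an explicit
solution possible. -/
theorem gapRecurrence_gapTwo (hy : ‖y‖ < 1) (hyp : y ^ 2 = p) (hp : ‖p‖ < 1) :
    GapRecurrence y y p (gapTwo y p) (gapThree y p) := by
  constructor <;> intro k
  · have h0 := gapTwo_sub hy hp k
    have h1 := gapTwo_sub hy hp (k + 1)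
    linear_combination h0 + y * p ^ k * h1 + p ^ (2 * k + 1) * gapTwo y p (k + 2) * hyp
  · linear_combination gapThree_sub hy hp k

theorem tendsto_gapTwo (hy : ‖y‖ < 1) (hp : ‖p‖ < 1) (j : ℕ) :
    Tendsto (fun k => ∑' m, gapCoeff y p k m * qFac (-y * p ^ (m + k + j)) p) atTop (𝓝 1) := by
  obtain ⟨M, hM⟩ := exists_bound_qFac_mul_pow (-y) hp
  refine tendsto_tsum_prod_range_mul (tendsto_mul_pow_mul (norm_nonneg p) hp _ _)
    (norm_gapCoeff_factor_le hy hp) ?_ (fun k m => hM _) ?_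
  · have h := (tendsto_pow_atTop_nhds_zero_of_norm_lt_one hp).comp (tendsto_add_atTop_nat 1)
    simpa [div_eq_mul_inv] using (h.mul_const (1 + y)).mul_const (1 - p)⁻¹
  · have h := (tendsto_qFac_mul_pow (-y) hp).comp
      (tendsto_atTop_mono (fun k : ℕ => show k ≤ 0 + k + j by omega) tendsto_id)
    exact h

theorem norm_lt_one_of_sq {t q : ℂ} (htq : t ^ 2 = q) (hq : ‖q‖ < 1) : ‖t‖ < 1 := by
  rw [← htq, norm_pow] at hq
  exact (sq_lt_one_iff₀ (norm_nonneg t)).1 hq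

theorem gapSum_eq_gapTwo {t q : ℂ} (ht : t ≠ 0) (htq : t ^ 2 = q) (hq : ‖q‖ < 1) (k : ℕ) :
    gapSum t q (3 * k + 2) = gapTwo (t ^ 3) (q ^ 3) k ∧
      gapSum t q (3 * k + 3) = gapThree (t ^ 3) (q ^ 3) k := by
  have hp := norm_pow_three_lt_one hq
  have hy := norm_pow_three_lt_one (norm_lt_one_of_sq htq hq)
  have h := gapRecurrence_gapSum ht hq
  have e1 : t * q = t ^ 3 := by rw [← htq]; ring
  have e2 : t⁻¹ * q ^ 2 = t ^ 3 := by rw [← htq]; field_simp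
  rw [e1, e2] at h
  exact h.unique hp (gapRecurrence_gapTwo hy (by rw [← htq]; ring) hp)
    (tendsto_gapSum_arith t hq 2) (tendsto_gapSum_arith t hq 3)
    (tendsto_gapTwo hy hp 0) (tendsto_gapTwo hy hp 1) k

theorem gapTwo_zero (hp : ‖p‖ < 1) : gapTwo y p 0 = qFac (-y) p * qFac (-p) p := by
  rw [← tsum_prod_eq_qFac p hp, gapTwo, ← tsum_mul_left]
  refine tsum_congr fun m => ?_
  rw [qFac_eq_prod_mul (-y) hp m, mul_right_comm, gapCoeff, ← Finset.prod_mul_distrib, add_zero]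
  congr 1
  exact Finset.prod_congr rfl fun i _ => by ring

/-- The sum to which the generating function of the partitions with parts at least `3` reduces
at `t ^ 2 = q`, with a parameter `n` in which it satisfies a recurrence. -/
noncomputable def kappa (y p : ℂ) (n : ℕ) : ℂ :=
  ∑' m, (∏ i ∈ Finset.range m, p ^ (n + i + 1) / (1 - p ^ (i + 1))) * (1 + y * p ^ (n + m))⁻¹

theorem norm_mul_pow_le (hp : ‖p‖ < 1) (j : ℕ) : ‖y * p ^ j‖ ≤ ‖y‖ := by
  rw [norm_mul, norm_pow]
  exact mul_le_of_le_one_right (norm_nonneg _) (pow_le_one₀ (norm_nonneg _) hp.le)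

theorem one_add_mul_pow_ne_zero (hy : ‖y‖ < 1) (hp : ‖p‖ < 1) (j : ℕ) : 1 + y * p ^ j ≠ 0 := by
  intro h
  have h1 := norm_mul_pow_le (y := y) hp j
  rw [eq_neg_of_add_eq_zero_right h, norm_neg, norm_one] at h1
  linarith

theorem gapThree_zero (hy : ‖y‖ < 1) (hp : ‖p‖ < 1) :
    gapThree y p 0 = qFac (-y) p * kappa y p 0 := by
  rw [gapThree, kappa, ← tsum_mul_left]
  refine tsum_congr fun m => ?_
  have h := one_add_mul_pow_ne_zero hy hp m
  have h1 := qFac_eq_mul (-y * p ^ m) hp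
  have e : -y * p ^ m * p = -y * p ^ (m + 1) := by ring
  rw [e] at h1
  have h2 : ∏ i ∈ Finset.range m, p ^ (0 + i + 1) * (1 + y * p ^ i) / (1 - p ^ (i + 1)) =
      (∏ i ∈ Finset.range m, (1 - -y * p ^ i)) *
        ∏ i ∈ Finset.range m, p ^ (0 + i + 1) / (1 - p ^ (i + 1)) := by
    rw [← Finset.prod_mul_distrib]
    exact Finset.prod_congr rfl fun i _ => by ring
  rw [qFac_eq_prod_mul (-y) hp m, h1, gapCoeff, h2, add_zero, zero_add]
  field_simp
  ring

theorem norm_kappa_factor_le (hp : ‖p‖ < 1) (n i : ℕ) :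
    ‖p ^ (n + i + 1) / (1 - p ^ (i + 1))‖ ≤ 1 * ‖p‖ ^ i * (1 - ‖p‖)⁻¹ := by
  have h1 := norm_inv_one_sub_pow_le hp i
  have h3 : ‖p‖ ^ (n + i + 1) ≤ ‖p‖ ^ i :=
    pow_le_pow_of_le_one (norm_nonneg _) hp.le (by omega)
  rw [div_eq_mul_inv, norm_mul, norm_pow, one_mul]
  gcongr

theorem summable_kappa (hy : ‖y‖ < 1) (hp : ‖p‖ < 1) (n : ℕ) :
    Summable fun m =>
      (∏ i ∈ Finset.range m, p ^ (n + i + 1) / (1 - p ^ (i + 1))) * (1 + y * p ^ (n + m))⁻¹ :=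
  summable_prod_range_mul (tendsto_mul_pow_mul (norm_nonneg p) hp _ _)
    (norm_kappa_factor_le hp n) fun _ => norm_inv_one_add_le (norm_mul_pow_le hp _) hy

theorem tendsto_kappa (hy : ‖y‖ < 1) (hp : ‖p‖ < 1) : Tendsto (kappa y p) atTop (𝓝 1) := by
  have hx := tendsto_pow_atTop_nhds_zero_of_norm_lt_one hp
  refine tendsto_tsum_prod_range_mul (tendsto_mul_pow_mul (norm_nonneg p) hp _ _)
    (norm_kappa_factor_le hp) ?_
    (fun k m => norm_inv_one_add_le (norm_mul_pow_le hp _) hy) ?_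
  · simpa [div_eq_mul_inv] using (hx.comp (tendsto_add_atTop_nat 1)).mul_const (1 - p)⁻¹
  · have h := ((hx.const_mul y).const_add 1).inv₀ (by simp)
    simpa using h

theorem kappa_rec (hy : ‖y‖ < 1) (hp : ‖p‖ < 1) (n : ℕ) :
    (1 + y * p ^ n) * kappa y p n =
      qFac (-p ^ (n + 1)) p + y * p ^ (2 * n + 1) * kappa y p (n + 1) := by
  have s0 : Summable fun m => ∏ i ∈ Finset.range m, p ^ (n + i + 1) / (1 - p ^ (i + 1)) := by
    simpa using summable_prod_range_mul (u := fun _ => 1) (M := 1)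
      (tendsto_mul_pow_mul (norm_nonneg p) hp _ _) (norm_kappa_factor_le hp n) (by simp)
  have h1 : qFac (-p ^ (n + 1)) p =
      ∑' m, ∏ i ∈ Finset.range m, p ^ (n + i + 1) / (1 - p ^ (i + 1)) := by
    rw [← tsum_prod_eq_qFac (p ^ (n + 1)) hp]
    exact tsum_congr fun m => Finset.prod_congr rfl fun i _ => by ring
  have s1 := (summable_kappa hy hp n).mul_left (1 + y * p ^ n)
  have h2 : (1 + y * p ^ n) * kappa y p n - qFac (-p ^ (n + 1)) p =
      y * p ^ (2 * n + 1) * kappa y p (n + 1) := by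
    rw [h1, kappa, kappa, ← tsum_mul_left, ← tsum_mul_left, ← s1.tsum_sub s0,
      (s1.sub s0).tsum_eq_zero_add]
    have h0 := one_add_mul_pow_ne_zero hy hp n
    simp only [Finset.range_zero, Finset.prod_empty, one_mul, add_zero, mul_inv_cancel₀ h0,
      sub_self, zero_add]
    refine tsum_congr fun m => ?_
    have hP : ∏ i ∈ Finset.range m, p ^ (n + 1 + i + 1) / (1 - p ^ (i + 1)) =
        p ^ m * ∏ i ∈ Finset.range m, p ^ (n + i + 1) / (1 - p ^ (i + 1)) := by
      rw [← Finset.card_range m, ← Finset.prod_const, Finset.card_range,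
        ← Finset.prod_mul_distrib]
      exact Finset.prod_congr rfl fun i _ => by ring
    have h3 := one_add_mul_pow_ne_zero hy hp (n + 1 + m)
    have h4 := one_sub_pow_succ_ne_zero hp m
    have e : n + (m + 1) = n + 1 + m := by ring
    rw [hP, Finset.prod_range_succ, e]
    field_simp
    ring
  linear_combination h2

/-! ### A false theta function of Rogers -/

/-- `∑ (-1) ^ m y ^ (a m + m (m + 1) / 2) / (-y ^ (b + 1); y)_m`. -/
noncomputable def falseSum (y : ℂ) (a b : ℕ) : ℂ :=
  ∑' m, ∏ i ∈ Finset.range m, -y ^ (a + i + 1) / (1 + y ^ (b + i + 1))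

theorem one_add_pow_succ_ne_zero (hy : ‖y‖ < 1) (j : ℕ) : 1 + y ^ (j + 1) ≠ 0 := by
  have := one_add_mul_pow_ne_zero hy hy j
  rwa [← pow_succ'] at this

theorem norm_falseSum_factor_le (hy : ‖y‖ < 1) (a b i : ℕ) :
    ‖-y ^ (a + i + 1) / (1 + y ^ (b + i + 1))‖ ≤ 1 * ‖y‖ ^ i * (1 - ‖y‖)⁻¹ := by
  have h1 : ‖(1 + y ^ (b + i + 1))⁻¹‖ ≤ (1 - ‖y‖)⁻¹ := by
    rw [pow_succ']
    exact norm_inv_one_add_le (norm_mul_pow_le hy _) hy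
  have h3 : ‖y‖ ^ (a + i + 1) ≤ ‖y‖ ^ i :=
    pow_le_pow_of_le_one (norm_nonneg _) hy.le (by omega)
  rw [div_eq_mul_inv, norm_mul, norm_neg, norm_pow, one_mul]
  gcongr

theorem summable_falseSum (hy : ‖y‖ < 1) (a b : ℕ) :
    Summable fun m => ∏ i ∈ Finset.range m, -y ^ (a + i + 1) / (1 + y ^ (b + i + 1)) := by
  simpa using summable_prod_range_mul (u := fun _ => 1) (M := 1)
    (tendsto_mul_pow_mul (norm_nonneg y) hy _ _) (norm_falseSum_factor_le hy a b) (by simp)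

theorem tendsto_falseSum (hy : ‖y‖ < 1) (c : ℕ) :
    Tendsto (fun n => falseSum y (2 * n) (c * n)) atTop (𝓝 1) := by
  have h := tendsto_tsum_prod_range_mul (u := fun _ _ => 1) (M := 1)
    (tendsto_mul_pow_mul (norm_nonneg y) hy _ _)
    (fun n => norm_falseSum_factor_le hy (2 * n) (c * n)) ?_ (by simp) tendsto_const_nhds
  · simpa [falseSum] using h
  · have hx : Tendsto (fun n : ℕ => y ^ (2 * n + 0 + 1)) atTop (𝓝 0) :=
      (tendsto_pow_atTop_nhds_zero_of_norm_lt_one hy).comp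
        (tendsto_atTop_mono (fun n : ℕ => show n ≤ 2 * n + 0 + 1 by omega) tendsto_id)
    refine squeeze_zero_norm (a := fun n : ℕ => ‖y ^ (2 * n + 0 + 1)‖ * (1 - ‖y‖)⁻¹)
      (fun n => ?_) (by simpa using hx.norm.mul_const (1 - ‖y‖)⁻¹)
    rw [div_eq_mul_inv, norm_mul, norm_neg]
    gcongr
    rw [pow_succ']
    exact norm_inv_one_add_le (norm_mul_pow_le hy _) hy

theorem falseSum_diag (hy : ‖y‖ < 1) (k : ℕ) :
    falseSum y k k = 1 - y ^ (k + 1) / (1 + y ^ (k + 1)) * falseSum y (k + 1) (k + 1) := by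
  rw [falseSum, falseSum, (summable_falseSum hy k k).tsum_eq_zero_add, ← tsum_mul_left,
    Finset.range_zero, Finset.prod_empty, sub_eq_add_neg, ← tsum_neg]
  congr 1
  refine tsum_congr fun m => ?_
  rw [Finset.prod_range_succ', add_zero, mul_comm, neg_div, neg_mul]
  congr 2
  exact Finset.prod_congr rfl fun i _ => by ring_nf

/-- The step of the Rogers–Fine iteration. -/
theorem falseSum_rec (hy : ‖y‖ < 1) (n : ℕ) :
    falseSum y (2 * n) n =
      1 - y ^ (2 * n + 1) + y ^ (3 * n + 2) * falseSum y (2 * (n + 1)) (n + 1) := by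
  set φ : ℕ → ℂ := fun m =>
    ∏ i ∈ Finset.range m, -y ^ (2 * n + i + 1) / (1 + y ^ (n + i + 1)) with hφ
  have s : Summable φ := summable_falseSum hy (2 * n) n
  have s' : Summable fun m => y ^ m * φ m := by
    refine Summable.of_norm_bounded s.norm fun m => ?_
    rw [norm_mul, norm_pow]
    exact mul_le_of_le_one_left (norm_nonneg _) (pow_le_one₀ (norm_nonneg _) hy.le)
  have hstep : ∀ m, (1 + y ^ (n + m + 1)) * φ (m + 1) = -y ^ (2 * n + m + 1) * φ m := by
    intro m
    have := one_add_pow_succ_ne_zero hy (n + m)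
    simp only [hφ, Finset.prod_range_succ]
    field_simp
  have h0 : φ 0 = 1 := by simp [hφ]
  have hS : falseSum y (2 * n) n = 1 + ∑' m, φ (m + 1) := by
    have h := s.tsum_eq_zero_add
    rw [h0] at h
    exact h
  have hS' : ∑' m, y ^ m * φ m = 1 + ∑' m, y ^ (m + 1) * φ (m + 1) := by
    rw [s'.tsum_eq_zero_add, h0, pow_zero, one_mul]
  have s1 : Summable fun m => φ (m + 1) := (summable_nat_add_iff (f := φ) 1).2 s
  have s1' : Summable fun m => y ^ (m + 1) * φ (m + 1) :=
    (summable_nat_add_iff (f := fun m => y ^ m * φ m) 1).2 s'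
  have h1 : y ^ n * ∑' m, y ^ (m + 1) * φ (m + 1) =
      -∑' m, φ (m + 1) - y ^ (2 * n + 1) * ∑' m, y ^ m * φ m := by
    rw [← tsum_mul_left, ← tsum_mul_left, ← tsum_neg, ← s1.neg.tsum_sub (s'.mul_left _)]
    exact tsum_congr fun m => by linear_combination hstep m
  have h2 : y ^ (3 * n + 2) * falseSum y (2 * (n + 1)) (n + 1) =
      -(1 + y ^ (n + 1)) * y ^ n * ∑' m, y ^ (m + 1) * φ (m + 1) := by
    rw [falseSum, ← tsum_mul_left, ← tsum_mul_left]
    refine tsum_congr fun m => ?_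
    have h3 : φ (m + 1) = (∏ i ∈ Finset.range m,
        -y ^ (2 * n + (i + 1) + 1) / (1 + y ^ (n + (i + 1) + 1))) *
          (-y ^ (2 * n + 0 + 1) / (1 + y ^ (n + 0 + 1))) :=
      Finset.prod_range_succ' (fun i => -y ^ (2 * n + i + 1) / (1 + y ^ (n + i + 1))) m
    have h4 : ∏ i ∈ Finset.range m,
        -y ^ (2 * (n + 1) + i + 1) / (1 + y ^ (n + 1 + i + 1)) = y ^ m * ∏ i ∈ Finset.range m,
        -y ^ (2 * n + (i + 1) + 1) / (1 + y ^ (n + (i + 1) + 1)) := by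
      rw [← Finset.card_range m, ← Finset.prod_const, Finset.card_range,
        ← Finset.prod_mul_distrib]
      exact Finset.prod_congr rfl fun i _ => by ring_nf
    have h5 := one_add_pow_succ_ne_zero hy n
    rw [h3, h4, add_zero, add_zero]
    field_simp
    ring
  rw [h2]
  rw [hS'] at h1
  rw [hS]
  linear_combination h1

/-- The terms `y ^ (n (3 n + 1) / 2) (1 - y ^ (2 n + 1))` of the false theta function. With
alternating signs they sum to `(y; y)_∞`. -/
noncomputable def pentTerm (y : ℂ) (n : ℕ) : ℂ := y ^ (n * (3 * n + 1) / 2) * (1 - y ^ (2 * n + 1))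

theorem le_pent (n : ℕ) : n ≤ n * (3 * n + 1) / 2 := by
  rw [Nat.le_div_iff_mul_le (by norm_num)]
  nlinarith [Nat.zero_le n, n.le_mul_self]

theorem pent_succ (n : ℕ) :
    (n + 1) * (3 * (n + 1) + 1) / 2 = n * (3 * n + 1) / 2 + (3 * n + 2) := by
  have e : (n + 1) * (3 * (n + 1) + 1) = n * (3 * n + 1) + 2 * (3 * n + 2) := by ring
  rw [e, Nat.add_mul_div_left _ _ (by norm_num)]

theorem summable_norm_pentTerm (hy : ‖y‖ < 1) : Summable fun n => ‖pentTerm y n‖ := by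
  refine Summable.of_nonneg_of_le (fun _ => norm_nonneg _) (fun n => ?_)
    ((summable_geometric_of_lt_one (norm_nonneg y) hy).mul_right 2)
  rw [pentTerm, norm_mul, norm_pow]
  gcongr ?_ * ?_
  · exact pow_le_pow_of_le_one (norm_nonneg _) hy.le (le_pent n)
  · refine (norm_sub_le _ _).trans ?_
    rw [norm_one, norm_pow]
    have := pow_le_one₀ (norm_nonneg y) hy.le (n := 2 * n + 1)
    linarith

/-- Rogers' identity
`∑ (-1) ^ m y ^ (m (m + 1) / 2) / (-y; y)_m = ∑ y ^ (n (3 n + 1) / 2) (1 - y ^ (2 n + 1))`. -/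
theorem falseSum_zero (hy : ‖y‖ < 1) : falseSum y 0 0 = ∑' n, pentTerm y n := by
  have h : ∀ n, falseSum y 0 0 = ∑ j ∈ Finset.range n, pentTerm y j +
      y ^ (n * (3 * n + 1) / 2) * falseSum y (2 * n) n := by
    intro n
    induction n with
    | zero => simp
    | succ n ih =>
      rw [ih, falseSum_rec hy n, Finset.sum_range_succ, pent_succ, pentTerm]
      ring
  have h1 : Tendsto (fun n : ℕ => y ^ (n * (3 * n + 1) / 2)) atTop (𝓝 0) :=
    (tendsto_pow_atTop_nhds_zero_of_norm_lt_one hy).comp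
      (tendsto_atTop_mono le_pent tendsto_id)
  have h2 := (summable_norm_pentTerm hy).of_norm.hasSum.tendsto_sum_nat
  have h3 := h2.add (h1.mul (tendsto_falseSum hy 1))
  simp only [one_mul, zero_mul, add_zero] at h3
  exact tendsto_nhds_unique (tendsto_const_nhds.congr h) h3

/-- Both sides have the limit `1` in `n`, and their difference satisfies a first order recurrence
without inhomogeneous term. -/
theorem kappa_eq (hy : ‖y‖ < 1) (hyp : y ^ 2 = p) (hp : ‖p‖ < 1) (n : ℕ) :
    kappa y p n = qFac (-p ^ (n + 1)) p * falseSum y (2 * n) (2 * n) := by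
  have hpow : ∀ k : ℕ, p ^ k = y ^ (2 * k) := fun k => by rw [← hyp, pow_mul]
  rw [← sub_eq_zero]
  refine eq_zero_of_eq_mul_succ
    (a := fun n => kappa y p n - qFac (-p ^ (n + 1)) p * falseSum y (2 * n) (2 * n))
    (c := fun n => y ^ (4 * n + 3) / (1 + y ^ (2 * n + 1))) (fun n => ?_) ?_ ?_ n
  · have h1 := kappa_rec hy hp n
    have h2 := falseSum_diag hy (2 * n)
    have h3 := falseSum_diag hy (2 * n + 1)
    have h4 := qFac_eq_mul (-p ^ (n + 1)) hp
    have e : -p ^ (n + 1) * p = -p ^ (n + 1 + 1) := by ring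
    rw [e] at h4
    have n1 := one_add_pow_succ_ne_zero hy (2 * n)
    have n2 := one_add_pow_succ_ne_zero hy (2 * n + 1)
    have e2 : 2 * (n + 1) = 2 * n + 1 + 1 := by ring
    have e3 : y * p ^ n = y ^ (2 * n + 1) := by rw [hpow]; ring
    have e4 : y * p ^ (2 * n + 1) = y ^ (4 * n + 3) := by rw [hpow]; ring
    rw [e3, e4] at h1
    have e5 : 1 - -p ^ (n + 1) = 1 + y ^ (2 * n + 1 + 1) := by rw [hpow]; ring
    rw [e5] at h4
    have e6 : 1 + y ^ (2 * n + 1 + 1) ≠ 0 := n2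
    simp only [e2]
    rw [h2, h3, h4]
    rw [h4] at h1
    have h5 : kappa y p n = ((1 + y ^ (2 * n + 1 + 1)) * qFac (-p ^ (n + 1 + 1)) p +
        y ^ (4 * n + 3) * kappa y p (n + 1)) / (1 + y ^ (2 * n + 1)) := by
      rw [← h1, mul_div_cancel_left₀ _ n1]
    rw [h5]
    field_simp
    ring
  · have hx := tendsto_pow_atTop_nhds_zero_of_norm_lt_one hy
    have h1 := hx.comp (tendsto_atTop_mono (fun n : ℕ => show n ≤ 4 * n + 3 by omega) tendsto_id)
    have h2 := hx.comp (tendsto_atTop_mono (fun n : ℕ => show n ≤ 2 * n + 1 by omega) tendsto_id)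
    have h3 := h1.div (h2.const_add 1) (by simp)
    rw [zero_div] at h3
    exact h3
  · have h1 := (tendsto_qFac_mul_pow (-p) hp).congr fun k => by
      rw [neg_mul, ← pow_succ']
    simpa using (tendsto_kappa hy hp).sub (h1.mul (tendsto_falseSum hy 2))

theorem gapSum_two_of_sq {t q : ℂ} (ht : t ≠ 0) (htq : t ^ 2 = q) (hq : ‖q‖ < 1) :
    gapSum t q 2 = qFac (-t ^ 3) (q ^ 3) * qFac (-q ^ 3) (q ^ 3) := by
  rw [← gapTwo_zero (norm_pow_three_lt_one hq)]
  exact (gapSum_eq_gapTwo ht htq hq 0).1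

theorem gapSum_three_of_sq {t q : ℂ} (ht : t ≠ 0) (htq : t ^ 2 = q) (hq : ‖q‖ < 1) :
    gapSum t q 3 = gapSum t q 2 * ∑' n, pentTerm (t ^ 3) n := by
  have hp := norm_pow_three_lt_one hq
  have hy := norm_pow_three_lt_one (norm_lt_one_of_sq htq hq)
  have h := (gapSum_eq_gapTwo ht htq hq 0).2
  rw [gapThree_zero hy hp, kappa_eq hy (by rw [← htq]; ring) hp, zero_add, pow_one, mul_zero,
    falseSum_zero hy, ← mul_assoc, ← gapSum_two_of_sq ht htq hq] at h
  exact h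

theorem gapSumStar_of_sq {t q : ℂ} (ht : t ≠ 0) (htq : t ^ 2 = q) (hq : ‖q‖ < 1) :
    gapSumStar t q = gapSum t q 2 := by
  have hp := norm_pow_three_lt_one hq
  have hy := norm_pow_three_lt_one (norm_lt_one_of_sq htq hq)
  have h := gapTwo_sub hy hp 0
  rw [← (gapSum_eq_gapTwo ht htq hq 0).1, ← (gapSum_eq_gapTwo ht htq hq 0).2,
    ← (gapSum_eq_gapTwo ht htq hq (0 + 1)).1] at h
  norm_num at h
  have e1 : t * q = t ^ 3 := by rw [← htq]; ring
  rw [gapSumStar, ← h, e1]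
  ring

end

/-! ### Laurent series on the punctured plane -/

/-- `f` is, on the punctured plane, the sum of an absolutely convergent family of monomials. The
exponents need not be distinct, so that a sum over partitions is of this form as it stands. -/
def IsLaurent (f : ℂ → ℂ) : Prop :=
  ∃ (ι : Type) (a : ι → ℂ) (d : ι → ℤ), ∀ t : ℂ, t ≠ 0 →
    Summable (fun i => ‖a i * t ^ d i‖) ∧ f t = ∑' i, a i * t ^ d i

/-- `f` is, on the punctured plane, the sum of an absolutely convergent Laurent series with
coefficients `c`. -/
def HasLaurent (f : ℂ → ℂ) (c : ℤ → ℂ) : Prop :=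
  ∀ t : ℂ, t ≠ 0 → Summable (fun n => ‖c n * t ^ n‖) ∧ f t = ∑' n, c n * t ^ n

theorem HasLaurent.isLaurent {f : ℂ → ℂ} {c : ℤ → ℂ} (h : HasLaurent f c) : IsLaurent f :=
  ⟨ℤ, c, id, h⟩

/-- Collecting the monomials with equal exponents. -/
theorem IsLaurent.exists_hasLaurent {f : ℂ → ℂ} (h : IsLaurent f) : ∃ c, HasLaurent f c := by
  obtain ⟨ι, a, d, h⟩ := h
  refine ⟨fun n => ∑' i : {i // d i = n}, a i, fun t ht => ?_⟩
  obtain ⟨h1, h2⟩ := h t ht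
  have h3 : Summable fun x : Σ n, {i // d i = n} => ‖a x.2 * t ^ x.1‖ := by
    have h0 := (Equiv.sigmaFiberEquiv d).summable_iff (f := fun i => ‖a i * t ^ d i‖)
    refine (h0.2 h1).congr fun x => ?_
    obtain ⟨n, i, rfl⟩ := x
    rfl
  have h4 : ∀ n, (∑' i : {i // d i = n}, a i) * t ^ n = ∑' i : {i // d i = n}, a i * t ^ n :=
    fun n => tsum_mul_right.symm
  constructor
  · refine Summable.of_nonneg_of_le (fun _ => norm_nonneg _) (fun n => ?_) h3.sigma
    rw [h4]
    exact norm_tsum_le_tsum_norm (h3.sigma_factor n)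
  · rw [h2, ← (Equiv.sigmaFiberEquiv d).tsum_eq]
    have h5 : ∑' x : Σ n, {i // d i = n}, a x.2 * t ^ x.1 =
        ∑' n, ∑' i : {i // d i = n}, a i * t ^ n := Summable.tsum_sigma h3.of_norm
    simp only [h4]
    rw [← h5]
    refine tsum_congr fun x => ?_
    obtain ⟨n, i, rfl⟩ := x
    rfl

/-- The coefficients of the zero function vanish, since the monomials are orthonormal on the unit
circle. -/
theorem HasLaurent.eq_zero {c : ℤ → ℂ} (h : HasLaurent (fun _ => 0) c) : c = 0 := by
  have hT : Fact ((0 : ℝ) < 1) := ⟨one_pos⟩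
  have hc : Summable fun n => ‖c n‖ := by simpa using (h 1 one_ne_zero).1
  have hs : Summable fun n => c n • (fourier n : C(AddCircle (1 : ℝ), ℂ)) := by
    refine Summable.of_norm ?_
    simpa [norm_smul, fourier_norm] using hc
  have h0 : ∑' n, c n • (fourier n : C(AddCircle (1 : ℝ), ℂ)) = 0 := by
    ext x
    rw [← ContinuousMap.tsum_apply hs]
    have hx : ((AddCircle.toCircle x : Circle) : ℂ) ≠ 0 := Circle.coe_ne_zero _
    have h1 := (h _ hx).2
    rw [ContinuousMap.zero_apply]
    refine (tsum_congr fun n => ?_).trans h1.symm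
    rw [ContinuousMap.smul_apply, fourier_apply, AddCircle.toCircle_zsmul, Circle.coe_zpow,
      smul_eq_mul]
  have h2 := hs.hasSum
  rw [h0] at h2
  have h3 := h2.mapL
    (ContinuousMap.toLp 2 (AddCircle.haarAddCircle (T := (1 : ℝ))) ℂ)
  funext m
  have h4 := h3.mapL (innerSL ℂ (fourierLp (T := (1 : ℝ)) 2 m))
  have h5 := orthonormal_iff_ite.1 (orthonormal_fourier (T := (1 : ℝ))) m
  have h6 : HasSum (fun n => if n = m then c n else 0) (0 : ℂ) := by
    convert! h4 using 1
    · funext n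
      rw [map_smul, map_smul, innerSL_apply_apply]
      change _ = c n • inner ℂ (fourierLp 2 m) (fourierLp 2 n)
      rw [h5 n]
      by_cases hnm : n = m
      · simp [hnm]
      · simp [hnm, Ne.symm hnm]
    · simp
  have h7 : HasSum (fun n => if n = m then c n else 0) (c m) := by
    convert! hasSum_ite_eq m (c m) using 2 with n
    split_ifs with h <;> simp [h]
  exact h7.unique h6

theorem HasLaurent.sub {f g : ℂ → ℂ} {c e : ℤ → ℂ} (hf : HasLaurent f c) (hg : HasLaurent g e) :
    HasLaurent (fun t => f t - g t) (fun n => c n - e n) := by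
  intro t ht
  have h1 := hf t ht
  have h2 := hg t ht
  constructor
  · refine Summable.of_nonneg_of_le (fun _ => norm_nonneg _) (fun n => ?_) (h1.1.add h2.1)
    rw [sub_mul]
    exact norm_sub_le _ _
  · beta_reduce
    rw [h1.2, h2.2, ← h1.1.of_norm.tsum_sub h2.1.of_norm]
    exact tsum_congr fun n => by ring

theorem HasLaurent.congr {f g : ℂ → ℂ} {c : ℤ → ℂ} (hf : HasLaurent f c)
    (h : ∀ t, t ≠ 0 → f t = g t) : HasLaurent g c :=
  fun t ht => ⟨(hf t ht).1, by rw [← h t ht]; exact (hf t ht).2⟩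

/-- The coefficients of a Laurent series are unique. -/
theorem HasLaurent.unique {f g : ℂ → ℂ} {c e : ℤ → ℂ} (hf : HasLaurent f c)
    (hg : HasLaurent g e) (h : ∀ t, t ≠ 0 → f t = g t) (n : ℤ) : c n = e n := by
  have h1 : HasLaurent (fun _ => 0) (fun n => c n - e n) :=
    (hf.sub hg).congr fun t ht => sub_eq_zero.2 (h t ht)
  exact sub_eq_zero.1 (congrFun h1.eq_zero n)

theorem HasLaurent.const_mul {f : ℂ → ℂ} {c : ℤ → ℂ} (hf : HasLaurent f c) (C : ℂ) :
    HasLaurent (fun t => C * f t) (fun n => C * c n) := by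
  intro t ht
  have h1 := hf t ht
  constructor
  · refine (h1.1.mul_left ‖C‖).congr fun n => ?_
    rw [mul_assoc, norm_mul C]
  · beta_reduce
    rw [h1.2, ← tsum_mul_left]
    exact tsum_congr fun n => by ring

theorem HasLaurent.comp_mul {f : ℂ → ℂ} {c : ℤ → ℂ} (hf : HasLaurent f c) {P : ℂ} (hP : P ≠ 0) :
    HasLaurent (fun t => f (t * P)) (fun n => c n * P ^ n) := by
  intro t ht
  have h1 := hf (t * P) (mul_ne_zero ht hP)
  simp only [mul_zpow] at h1
  have e : ∀ n : ℤ, c n * P ^ n * t ^ n = c n * (t ^ n * P ^ n) := fun n => by ring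
  simpa only [e] using h1

theorem HasLaurent.comp_div {f : ℂ → ℂ} {c : ℤ → ℂ} (hf : HasLaurent f c) {q : ℂ} (hq : q ≠ 0) :
    HasLaurent (fun t => f (q / t)) (fun n => c (-n) * q ^ (-n)) := by
  intro t ht
  have h1 := hf (q / t) (div_ne_zero hq ht)
  have e : ∀ n : ℤ, c (-n) * q ^ (-n) * t ^ n = c (-n) * (q / t) ^ (-n) := fun n => by
    rw [div_zpow, zpow_neg t, div_inv_eq_mul, mul_assoc]
  simp only [e]
  have h2 := (Equiv.neg ℤ).summable_iff (f := fun n => ‖c n * (q / t) ^ n‖)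
  have h3 := (Equiv.neg ℤ).tsum_eq (fun n => c n * (q / t) ^ n)
  exact ⟨h2.2 h1.1, h1.2.trans h3.symm⟩

theorem HasLaurent.pow_mul {f : ℂ → ℂ} {c : ℤ → ℂ} (hf : HasLaurent f c) (N : ℕ) :
    HasLaurent (fun t => t ^ N * f t) (fun n => c (n - N)) := by
  intro t ht
  have h1 := hf t ht
  have h2 : Summable fun n : ℤ => ‖t ^ N * (c n * t ^ n)‖ := by
    refine (h1.1.mul_left ‖t ^ N‖).congr fun n => ?_
    rw [norm_mul (t ^ N)]
  have e : ∀ n : ℤ, c (n - N) * t ^ n = t ^ N * (c (n - N) * t ^ (n - N : ℤ)) := fun n => by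
    rw [zpow_sub₀ ht, zpow_natCast]
    field_simp
  simp only [e]
  have h3 := (Equiv.subRight (N : ℤ)).summable_iff (f := fun n => ‖t ^ N * (c n * t ^ n)‖)
  have h4 := (Equiv.subRight (N : ℤ)).tsum_eq (fun n => t ^ N * (c n * t ^ n))
  refine ⟨h3.2 h2, ?_⟩
  rw [h1.2, ← tsum_mul_left]
  exact h4.symm

/-- A quasi-periodicity, in terms of coefficients. -/
theorem HasLaurent.coeff_rec {f : ℂ → ℂ} {c : ℤ → ℂ} (hf : HasLaurent f c) {P C : ℂ} (hP : P ≠ 0)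
    {N : ℕ} (h : ∀ t, t ≠ 0 → t ^ N * f (t * P) = C * f t) (n : ℤ) :
    c n * P ^ n = C * c (n + N) := by
  have h1 := ((hf.comp_mul hP).pow_mul N).unique (hf.const_mul C) h (n + N)
  simpa using h1

theorem coeff_eq_zero {c : ℤ → ℂ} {P C : ℂ} (hP : P ≠ 0) (hC : C ≠ 0) {N : ℤ}
    (h : ∀ n, c n * P ^ n = C * c (n + N)) {j : ℤ} (hj : c j = 0) (k : ℤ) :
    c (j + N * k) = 0 := by
  induction k using Int.induction_on with
  | zero => simpa using hj
  | succ k ih =>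
    have h1 := h (j + N * k)
    rw [ih, zero_mul, add_assoc, ← mul_add_one] at h1
    exact (mul_eq_zero.1 h1.symm).resolve_left hC
  | pred k ih =>
    have h1 := h (j + N * (-k - 1))
    rw [add_assoc, ← mul_add_one, sub_add_cancel, ih, mul_zero] at h1
    exact (mul_eq_zero.1 h1).resolve_right (zpow_ne_zero _ hP)

/-- Quasi-periodic Laurent series whose exponents lie in one class modulo the order `N` of the
quasi-periodicity form a space of dimension at most one. Hence a member that vanishes where another
one does not is zero. -/
theorem HasLaurent.eq_zero_of_quasiperiodic {f g : ℂ → ℂ} {c e : ℤ → ℂ} (hf : HasLaurent f c)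
    (hg : HasLaurent g e) {P C : ℂ} (hP : P ≠ 0) (hC : C ≠ 0) {N : ℕ}
    (hfP : ∀ t, t ≠ 0 → t ^ N * f (t * P) = C * f t)
    (hgP : ∀ t, t ≠ 0 → t ^ N * g (t * P) = C * g t) {j : ℤ}
    (hc : ∀ n, (∀ k : ℤ, n ≠ j + N * k) → c n = 0)
    (he : ∀ n, (∀ k : ℤ, n ≠ j + N * k) → e n = 0)
    {t₀ : ℂ} (ht₀ : t₀ ≠ 0) (hf₀ : f t₀ = 0) (hg₀ : g t₀ ≠ 0) {t : ℂ} (ht : t ≠ 0) : f t = 0 := by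
  have hcr := hf.coeff_rec hP hfP
  have her := hg.coeff_rec hP hgP
  have aux : ∀ u : ℤ → ℂ, (∀ n, u n * P ^ n = C * u (n + N)) →
      (∀ n, (∀ k : ℤ, n ≠ j + N * k) → u n = 0) → u j = 0 → u = 0 := by
    intro u hu hu' hj
    funext n
    by_cases hn : ∀ k : ℤ, n ≠ j + N * k
    · exact hu' n hn
    · push Not at hn
      obtain ⟨k, rfl⟩ := hn
      exact coeff_eq_zero hP hC hu hj k
  have hej : e j ≠ 0 := by
    intro h
    apply hg₀
    rw [(hg t₀ ht₀).2, aux e her he h]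
    simp
  have hu := aux (fun n => e j * c n - c j * e n)
    (fun n => by linear_combination e j * hcr n - c j * her n)
    (fun n hn => by rw [hc n hn, he n hn]; ring) (by ring)
  have h1 := ((hf.const_mul (e j)).sub (hg.const_mul (c j))) t₀ ht₀
  beta_reduce at h1
  rw [hf₀, tsum_congr fun n => by rw [congrFun hu n]] at h1
  have h2 : c j * g t₀ = 0 := by simpa using h1.2
  have hcj : c j = 0 := (mul_eq_zero.1 h2).resolve_right hg₀
  rw [(hf t ht).2, aux c hcr hc hcj]
  simp

theorem IsLaurent.congr {f g : ℂ → ℂ} (hf : IsLaurent f) (h : ∀ t, t ≠ 0 → f t = g t) :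
    IsLaurent g := by
  obtain ⟨ι, a, d, hf⟩ := hf
  exact ⟨ι, a, d, fun t ht => ⟨(hf t ht).1, by rw [← h t ht]; exact (hf t ht).2⟩⟩

theorem IsLaurent.const_mul {f : ℂ → ℂ} (hf : IsLaurent f) (C : ℂ) :
    IsLaurent (fun t => C * f t) := by
  obtain ⟨c, hc⟩ := hf.exists_hasLaurent
  exact (hc.const_mul C).isLaurent

theorem IsLaurent.sub {f g : ℂ → ℂ} (hf : IsLaurent f) (hg : IsLaurent g) :
    IsLaurent (fun t => f t - g t) := by
  obtain ⟨c, hc⟩ := hf.exists_hasLaurent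
  obtain ⟨e, he⟩ := hg.exists_hasLaurent
  exact (hc.sub he).isLaurent

theorem IsLaurent.add {f g : ℂ → ℂ} (hf : IsLaurent f) (hg : IsLaurent g) :
    IsLaurent (fun t => f t + g t) :=
  (hf.sub (hg.const_mul (-1))).congr fun t _ => by ring

theorem IsLaurent.mul {f g : ℂ → ℂ} (hf : IsLaurent f) (hg : IsLaurent g) :
    IsLaurent (fun t => f t * g t) := by
  obtain ⟨ι, a, d, hf⟩ := hf
  obtain ⟨κ, b, e, hg⟩ := hg
  refine ⟨ι × κ, fun x => a x.1 * b x.2, fun x => d x.1 + e x.2, fun t ht => ?_⟩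
  have h1 := hf t ht
  have h2 := hg t ht
  have he : ∀ x : ι × κ, a x.1 * b x.2 * t ^ (d x.1 + e x.2) =
      (a x.1 * t ^ d x.1) * (b x.2 * t ^ e x.2) := fun x => by
    rw [zpow_add₀ ht]
    ring
  simp only [he]
  have key : ∀ (u : ι → ℂ) (v : κ → ℂ), Summable (fun i => ‖u i‖) → Summable (fun i => ‖v i‖) →
      Summable (fun x : ι × κ => ‖u x.1 * v x.2‖) ∧
        (∑' i, u i) * ∑' i, v i = ∑' x : ι × κ, u x.1 * v x.2 :=
    fun u v hu hv => ⟨hu.mul_norm hv, tsum_mul_tsum_of_summable_norm hu hv⟩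
  have h3 := key (fun i => a i * t ^ d i) (fun i => b i * t ^ e i) h1.1 h2.1
  rw [h1.2, h2.2]
  exact h3

theorem IsLaurent.comp_mul_zpow {f : ℂ → ℂ} (hf : IsLaurent f) {C : ℂ} (hC : C ≠ 0) (m : ℤ) :
    IsLaurent (fun t => f (C * t ^ m)) := by
  obtain ⟨ι, a, d, hf⟩ := hf
  refine ⟨ι, fun i => a i * C ^ d i, fun i => m * d i, fun t ht => ?_⟩
  have h1 := hf (C * t ^ m) (mul_ne_zero hC (zpow_ne_zero m ht))
  have e : ∀ i, a i * C ^ d i * t ^ (m * d i) = a i * (C * t ^ m) ^ d i := fun i => by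
    rw [mul_zpow, zpow_mul, mul_assoc]
  simpa only [e] using h1

theorem IsLaurent.comp_mul {f : ℂ → ℂ} (hf : IsLaurent f) {C : ℂ} (hC : C ≠ 0) :
    IsLaurent (fun t => f (t * C)) :=
  (hf.comp_mul_zpow hC 1).congr fun t _ => by rw [zpow_one, mul_comm]

theorem IsLaurent.comp_neg {f : ℂ → ℂ} (hf : IsLaurent f) : IsLaurent (fun t => f (-t)) :=
  (hf.comp_mul (neg_ne_zero.2 one_ne_zero)).congr fun t _ => by rw [mul_neg_one]

theorem IsLaurent.comp_div {f : ℂ → ℂ} (hf : IsLaurent f) {q : ℂ} (hq : q ≠ 0) :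
    IsLaurent (fun t => f (q / t)) :=
  (hf.comp_mul_zpow hq (-1)).congr fun t _ => by rw [zpow_neg_one, div_eq_mul_inv]

theorem isLaurent_id : IsLaurent (fun t => t) :=
  ⟨Unit, fun _ => 1, fun _ => 1, fun t _ =>
    ⟨summable_of_hasFiniteSupport (Set.toFinite _), by simp⟩⟩

/-- The expansion of the infinite product over the finite sets of its factors. -/
theorem isLaurent_qFac {q : ℂ} (hq : ‖q‖ < 1) : IsLaurent (fun z => qFac (-z) q) := by
  refine ⟨Finset ℕ, fun S => ∏ j ∈ S, q ^ j, fun S => S.card, fun z _ => ?_⟩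
  have h1 : Summable fun j : ℕ => ‖z * q ^ j‖ := by
    simpa [norm_mul, norm_pow] using
      (summable_geometric_of_lt_one (norm_nonneg q) hq).mul_left ‖z‖
  have e : ∀ S : Finset ℕ, (∏ j ∈ S, q ^ j) * z ^ (S.card : ℤ) = ∏ j ∈ S, z * q ^ j := fun S => by
    rw [Finset.prod_mul_distrib, Finset.prod_const, zpow_natCast, mul_comm]
  simp only [e]
  refine ⟨?_, ?_⟩
  · simpa [norm_prod] using summable_finsetProd_of_summable_nonneg (fun _ => norm_nonneg _) h1
  · rw [← tprod_one_add (summable_finsetProd_of_summable_norm h1), qFac]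
    exact tprod_congr fun j => by ring

theorem isLaurent_theta {q : ℂ} (hq0 : q ≠ 0) (hq : ‖q‖ < 1) : IsLaurent (fun z => theta z q) := by
  have h1 := isLaurent_qFac hq
  have h2 := (h1.mul (h1.comp_div hq0)).const_mul (qFac q q)
  refine h2.congr fun z _ => ?_
  rw [theta, div_eq_mul_inv]
  ring_nf

theorem isLaurent_gapSum {q : ℂ} (hq : ‖q‖ < 1) (m : ℕ) : IsLaurent (fun t => gapSum t q m) := by
  refine ⟨gapSets m, fun S => ∏ p ∈ S.1, q ^ p,
    fun S => ∑ p ∈ S.1, if p % 3 = 1 then 1 else if p % 3 = 2 then -1 else 0, fun t ht => ?_⟩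
  have e : ∀ S : gapSets m, (∏ p ∈ S.1, q ^ p) *
      t ^ (∑ p ∈ S.1, if p % 3 = 1 then (1 : ℤ) else if p % 3 = 2 then -1 else 0) =
        setWeight t q S.1 := by
    intro S
    have hz : ∀ (T : Finset ℕ) (d : ℕ → ℤ), t ^ (∑ p ∈ T, d p) = ∏ p ∈ T, t ^ d p := by
      intro T d
      induction T using Finset.cons_induction with
      | empty => simp
      | cons a T ha ih => rw [Finset.sum_cons, Finset.prod_cons, zpow_add₀ ht, ih]
    rw [hz, ← Finset.prod_mul_distrib, setWeight]
    refine Finset.prod_congr rfl fun p _ => ?_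
    rw [partWeight, mul_comm]
    split_ifs <;> simp
  simp only [e]
  exact ⟨(summable_norm_setWeight t hq).subtype _, rfl⟩

theorem IsLaurent.eq_zero_of_quasiperiodic_one {f g : ℂ → ℂ} (hf : IsLaurent f) (hg : IsLaurent g)
    {P C : ℂ} (hP : P ≠ 0) (hC : C ≠ 0) (hfP : ∀ t, t ≠ 0 → t * f (t * P) = C * f t)
    (hgP : ∀ t, t ≠ 0 → t * g (t * P) = C * g t) {t₀ : ℂ} (ht₀ : t₀ ≠ 0) (hf₀ : f t₀ = 0)
    (hg₀ : g t₀ ≠ 0) {t : ℂ} (ht : t ≠ 0) : f t = 0 := by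
  obtain ⟨c, hc⟩ := hf.exists_hasLaurent
  obtain ⟨e, he⟩ := hg.exists_hasLaurent
  refine hc.eq_zero_of_quasiperiodic he hP hC (N := 1) (j := 0) (by simpa using hfP)
    (by simpa using hgP) (fun n hn => absurd (by simp) (hn n)) (fun n hn => absurd (by simp) (hn n))
    ht₀ hf₀ hg₀ ht

/-- An even function has only even exponents, and an odd function only odd exponents. -/
theorem HasLaurent.coeff_eq_zero_of_parity {f : ℂ → ℂ} {c : ℤ → ℂ} (hf : HasLaurent f c) {j : ℤ}
    (h : ∀ t, t ≠ 0 → f (-t) = (-1) ^ j * f t) (n : ℤ) (hn : ∀ k : ℤ, n ≠ j + (2 : ℕ) * k) :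
    c n = 0 := by
  have h1 := (hf.comp_mul (neg_ne_zero.2 (one_ne_zero (α := ℂ)))).unique (hf.const_mul ((-1) ^ j))
    (fun t ht => by rw [mul_neg_one]; exact h t ht) n
  have h2 : Odd (n - j) := by
    rw [← Int.not_even_iff_odd]
    rintro ⟨k, hk⟩
    exact hn k (by push_cast; omega)
  have h3 : ((-1 : ℂ)) ^ n = -(-1) ^ j := by
    have h4 : n = j + (n - j) := by ring
    rw [h4, zpow_add₀ (by norm_num), h2.neg_one_zpow, mul_neg_one]
  rw [h3] at h1
  have h5 : ((-1 : ℂ)) ^ j ≠ 0 := zpow_ne_zero _ (by norm_num)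
  have h6 : (2 * (-1 : ℂ) ^ j) * c n = 0 := by linear_combination -h1
  exact (mul_eq_zero.1 h6).resolve_left (mul_ne_zero two_ne_zero h5)

theorem IsLaurent.eq_zero_of_quasiperiodic_two {f g : ℂ → ℂ} (hf : IsLaurent f) (hg : IsLaurent g)
    {P C : ℂ} (hP : P ≠ 0) (hC : C ≠ 0) (hfP : ∀ t, t ≠ 0 → t ^ 2 * f (t * P) = C * f t)
    (hgP : ∀ t, t ≠ 0 → t ^ 2 * g (t * P) = C * g t) (j : ℤ)
    (hfj : ∀ t, t ≠ 0 → f (-t) = (-1) ^ j * f t) (hgj : ∀ t, t ≠ 0 → g (-t) = (-1) ^ j * g t)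
    {t₀ : ℂ} (ht₀ : t₀ ≠ 0) (hf₀ : f t₀ = 0) (hg₀ : g t₀ ≠ 0) {t : ℂ} (ht : t ≠ 0) : f t = 0 := by
  obtain ⟨c, hc⟩ := hf.exists_hasLaurent
  obtain ⟨e, he⟩ := hg.exists_hasLaurent
  exact hc.eq_zero_of_quasiperiodic he hP hC hfP hgP (hc.coeff_eq_zero_of_parity hfj)
    (he.coeff_eq_zero_of_parity hgj) ht₀ hf₀ hg₀ ht

/-! ### Theta functions -/

theorem theta_mul {z q : ℂ} (hz : z ≠ 0) (hq0 : q ≠ 0) (hq : ‖q‖ < 1) :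
    theta (z * q) q = z⁻¹ * theta z q := by
  have h1 := qFac_eq_mul (-z) hq
  have h2 := qFac_eq_mul (-z⁻¹) hq
  have e1 : -(z * q)⁻¹ * q = -z⁻¹ := by field_simp
  have e2 : -(z * q) = -z * q := by ring
  rw [theta, theta, e1, e2, h1, h2]
  field_simp
  ring

theorem theta_div {z q : ℂ} (hq0 : q ≠ 0) : theta (q / z) q = theta z q := by
  have e1 : -(q / z)⁻¹ * q = -z := by
    rw [inv_div]
    field_simp
  have e2 : -(q / z) = -z⁻¹ * q := by ring
  rw [theta, theta, e1, e2]
  ring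

theorem qFac_even_mul_odd (a : ℂ) {q : ℂ} (hq : ‖q‖ < 1) :
    qFac a (q ^ 2) * qFac (a * q) (q ^ 2) = qFac a q := by
  have hq2 : ‖q ^ 2‖ < 1 := norm_pow_lt_one hq two_ne_zero
  have e1 : ∀ j : ℕ, 1 - a * (q ^ 2) ^ j = 1 - a * q ^ (2 * j) := fun j => by rw [pow_mul]
  have e2 : ∀ j : ℕ, 1 - a * q * (q ^ 2) ^ j = 1 - a * q ^ (2 * j + 1) := fun j => by
    rw [pow_succ q (2 * j), pow_mul]
    ring
  have h := tprod_even_mul_odd (f := fun j : ℕ => 1 - a * q ^ j)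
    ((multipliable_congr e1).1 (multipliable_qFac a hq2))
    ((multipliable_congr e2).1 (multipliable_qFac (a * q) hq2))
  unfold qFac
  rw [tprod_congr e1, tprod_congr e2]
  exact h

theorem qFac_mul_qFac_neg (a : ℂ) {q : ℂ} (hq : ‖q‖ < 1) :
    qFac a q * qFac (-a) q = qFac (a ^ 2) (q ^ 2) := by
  have h := (multipliable_qFac a hq).tprod_mul (multipliable_qFac (-a) hq)
  have e : ∀ j : ℕ, 1 - a ^ 2 * (q ^ 2) ^ j = (1 - a * q ^ j) * (1 - -a * q ^ j) := fun j => by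
    ring
  unfold qFac
  rw [tprod_congr e, h]

theorem theta_ne_zero {z q : ℂ} (hq : ‖q‖ < 1) (h1 : ∀ j : ℕ, -z * q ^ j ≠ 1)
    (h2 : ∀ j : ℕ, -z⁻¹ * q * q ^ j ≠ 1) : theta z q ≠ 0 :=
  mul_ne_zero (mul_ne_zero (qFac_ne_zero hq h1) (qFac_ne_zero hq h2)) (qFac_self_ne_zero hq)

/-- The product `θ(y; y ^ 4) / (y ^ 2; y ^ 2)_∞`. -/
theorem theta_self_pow_four {y : ℂ} (hy0 : y ≠ 0) (hy : ‖y‖ < 1) :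
    theta y (y ^ 4) / qFac (y ^ 2) (y ^ 2) = qFac (-y) (y ^ 2) * qFac (-y ^ 2) (y ^ 2) := by
  have hp := norm_pow_lt_one hy two_ne_zero
  rw [div_eq_iff (qFac_self_ne_zero hp)]
  have h1 := qFac_even_mul_odd (-y) hp
  have h2 := qFac_mul_qFac_neg (y ^ 2) hp
  have e1 : (y ^ 2) ^ 2 = y ^ 4 := by ring
  have e2 : -y⁻¹ * y ^ 4 = -y * y ^ 2 := by field_simp
  rw [e1] at h1 h2
  rw [theta, e2, h1, ← h2]
  ring

/-- The factorization behind the value of `θ(-t ^ 2 q ^ 2; q ^ 6)` at `t ^ 2 = q`, where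
`y = t ^ 3`. -/
theorem theta_neg_sq {y : ℂ} (hy0 : y ≠ 0) (hy : ‖y‖ < 1) :
    theta (-y ^ 2) (y ^ 4) = qFac (-y) (y ^ 2) * qFac y y := by
  have hp := norm_pow_lt_one hy two_ne_zero
  have h1 := qFac_even_mul_odd y hy
  have h2 := qFac_mul_qFac_neg y hp
  have h3 := qFac_even_mul_odd (y ^ 2) hp
  have e1 : (y ^ 2) ^ 2 = y ^ 4 := by ring
  have e2 : -(-y ^ 2)⁻¹ * y ^ 4 = y ^ 2 := by field_simp
  have e3 : y ^ 2 * y ^ 2 = y ^ 4 := by ring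
  have e4 : y * y = y ^ 2 := by ring
  rw [e1, e3] at h3
  rw [e1] at h2
  rw [e4] at h1
  rw [theta, e2, neg_neg, ← h1, ← h3, ← h2]
  ring

theorem isLaurent_gapSumStar {q : ℂ} (hq : ‖q‖ < 1) : IsLaurent (fun t => gapSumStar t q) :=
  (isLaurent_gapSum hq 3).add (((isLaurent_id.const_mul q).mul (isLaurent_gapSum hq 5)).congr
    fun t _ => by ring)

theorem exists_sq_eq {q : ℂ} (hq0 : q ≠ 0) : ∃ r : ℂ, r ≠ 0 ∧ r ^ 2 = q := by
  obtain ⟨r, hr⟩ := IsAlgClosed.exists_pow_nat_eq q (n := 2) (by norm_num)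
  exact ⟨r, fun h => hq0 (by rw [← hr, h]; ring), hr⟩

/-- The product formula for `C₂^*`. Both sides satisfy `t f(t q ^ 6) = q⁻¹ f(t)`, the left side by
two substitutions `t ↦ t q ^ 3`, and they agree at a square root of `q`. -/
theorem gapSumStar_eq {t q : ℂ} (ht : t ≠ 0) (hq0 : q ≠ 0) (hq : ‖q‖ < 1) :
    gapSumStar t q = theta (t * q) (q ^ 6) / qFac (q ^ 3) (q ^ 3) := by
  have hq3 : q ^ 3 ≠ 0 := pow_ne_zero 3 hq0
  have hq6 : q ^ 6 ≠ 0 := pow_ne_zero 6 hq0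
  have hQ := norm_pow_lt_one hq (n := 6) (by norm_num)
  obtain ⟨r, hr0, hr⟩ := exists_sq_eq hq0
  have hr1 := norm_lt_one_of_sq hr hq
  have hy0 : r ^ 3 ≠ 0 := pow_ne_zero 3 hr0
  have hy := norm_pow_three_lt_one hr1
  have e1 : r * q = r ^ 3 := by rw [← hr]; ring
  have e2 : q ^ 6 = (r ^ 3) ^ 4 := by rw [← hr]; ring
  have e3 : q ^ 3 = (r ^ 3) ^ 2 := by rw [← hr]; ring
  have hval : theta (r * q) (q ^ 6) / qFac (q ^ 3) (q ^ 3) =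
      qFac (-r ^ 3) (q ^ 3) * qFac (-q ^ 3) (q ^ 3) := by
    rw [e1, e2, e3]
    exact theta_self_pow_four hy0 hy
  have hval' : gapSumStar r q = theta (r * q) (q ^ 6) / qFac (q ^ 3) (q ^ 3) := by
    rw [hval, gapSumStar_of_sq hr0 hr hq, gapSum_two_of_sq hr0 hr hq]
  have hg : IsLaurent fun t => theta (t * q) (q ^ 6) / qFac (q ^ 3) (q ^ 3) :=
    (((isLaurent_theta hq6 hQ).comp_mul hq0).const_mul (qFac (q ^ 3) (q ^ 3))⁻¹).congr
      fun t _ => by rw [div_eq_mul_inv, mul_comm]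
  have hgP : ∀ t : ℂ, t ≠ 0 → t * (theta (t * q ^ 6 * q) (q ^ 6) / qFac (q ^ 3) (q ^ 3)) =
      q⁻¹ * (theta (t * q) (q ^ 6) / qFac (q ^ 3) (q ^ 3)) := by
    intro t ht
    rw [show t * q ^ 6 * q = t * q * q ^ 6 by ring, theta_mul (mul_ne_zero ht hq0) hq6 hQ]
    field_simp
  have hfP : ∀ t : ℂ, t ≠ 0 → t * gapSumStar (t * q ^ 6) q = q⁻¹ * gapSumStar t q := by
    intro t ht
    rw [show t * q ^ 6 = t * q ^ 3 * q ^ 3 by ring, gapSumStar_shift (mul_ne_zero ht hq3) hq0 hq,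
      gapSum_two_shift ht hq0 hq]
    field_simp
  have h := ((isLaurent_gapSumStar hq).sub hg).eq_zero_of_quasiperiodic_one hg hq6
    (inv_ne_zero hq0) (fun t ht => by rw [mul_sub, hfP t ht, hgP t ht, mul_sub]) hgP hr0
    (sub_eq_zero.2 hval') ?_ ht
  · exact sub_eq_zero.1 h
  · rw [hval]
    exact mul_ne_zero (qFac_ne_zero_of_norm_lt (by rwa [norm_neg]) (norm_pow_three_lt_one hq))
      (qFac_ne_zero_of_norm_lt (by rw [norm_neg]; exact norm_pow_three_lt_one hq)
        (norm_pow_three_lt_one hq))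

/-- The product formula for `C₂`, which arises from `C₂^*` by `t ↦ t q ^ 3`. -/
theorem gapSum_two_eq {t q : ℂ} (ht : t ≠ 0) (hq0 : q ≠ 0) (hq : ‖q‖ < 1) :
    gapSum t q 2 = theta (t * q ^ 4) (q ^ 6) / qFac (q ^ 3) (q ^ 3) := by
  rw [← gapSumStar_shift ht hq0 hq, gapSumStar_eq (mul_ne_zero ht (pow_ne_zero 3 hq0)) hq0 hq,
    show t * q ^ 3 * q = t * q ^ 4 by ring]

theorem gapSum_two_div {t q : ℂ} (ht : t ≠ 0) (hq0 : q ≠ 0) (hq : ‖q‖ < 1) :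
    gapSum (q / t) q 2 = gapSumStar t q := by
  rw [gapSum_two_eq (div_ne_zero hq0 ht) hq0 hq, gapSumStar_eq ht hq0 hq,
    show q / t * q ^ 4 = q ^ 6 / (t * q) by field_simp, theta_div (pow_ne_zero 6 hq0)]

theorem gapSumStar_div {t q : ℂ} (ht : t ≠ 0) (hq0 : q ≠ 0) (hq : ‖q‖ < 1) :
    gapSumStar (q / t) q = gapSum t q 2 := by
  rw [← gapSum_two_div (div_ne_zero hq0 ht) hq0 hq, div_div_cancel₀ hq0]

/-! ### Partial and false theta series -/

theorem chi3_eq (m : ℤ) : chi3 m = if m % 3 = 0 then 1 else if m % 3 = 1 then -1 else 0 := by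
  have h : m % 3 = 0 ∨ m % 3 = 1 ∨ m % 3 = 2 := by omega
  rw [chi3, legendreSym.mod]
  rcases h with h | h | h
  · rw [show (m + 1) % ((3 : ℕ) : ℤ) = 1 by push_cast; omega, h]
    norm_num
  · rw [show (m + 1) % ((3 : ℕ) : ℤ) = 2 by push_cast; omega, h]
    norm_num
  · rw [show (m + 1) % ((3 : ℕ) : ℤ) = 0 by push_cast; omega, h]
    norm_num

theorem norm_chi3_le (m : ℤ) : ‖(chi3 m : ℂ)‖ ≤ 1 := by
  rw [chi3_eq]
  split_ifs <;> simp

/-- The series `∑ a k t ^ k q ^ (k ^ 2)` over the integers. -/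
noncomputable def thetaSeries (a : ℤ → ℂ) (q t : ℂ) : ℂ := ∑' k : ℤ, a k * t ^ k * q ^ (k ^ 2)

theorem summable_pow_mul_pow_sq {T ρ : ℝ} (hT : 0 ≤ T) (hρ0 : 0 ≤ ρ) (hρ : ρ < 1) :
    Summable fun k : ℕ => T ^ k * ρ ^ (k ^ 2) := by
  have h := summable_prod_range (X := fun i : ℕ => T * ρ ^ (2 * i + 1)) (fun i => by positivity) ?_
  · refine h.congr fun k => ?_
    rw [Finset.prod_mul_distrib, Finset.prod_const, Finset.card_range, Finset.prod_pow_eq_pow_sum]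
    congr 2
    induction k with
    | zero => simp
    | succ k ih => rw [Finset.sum_range_succ, ih]; ring
  · have h1 := (tendsto_pow_atTop_nhds_zero_of_lt_one hρ0 hρ).comp
      (tendsto_atTop_mono (fun i : ℕ => show i ≤ 2 * i + 1 by omega) tendsto_id)
    simpa using h1.const_mul T

theorem summable_thetaSeries {a : ℤ → ℂ} (ha : ∀ k, ‖a k‖ ≤ 1) {q : ℂ} (hq : ‖q‖ < 1) (t : ℂ) :
    Summable fun k : ℤ => ‖a k * t ^ k * q ^ (k ^ 2)‖ := by
  have h1 : ∀ k : ℤ, ‖a k * t ^ k * q ^ (k ^ 2)‖ ≤ ‖t ^ k * q ^ (k ^ 2)‖ := fun k => by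
    rw [mul_assoc, norm_mul]
    exact mul_le_of_le_one_left (norm_nonneg _) (ha k)
  refine Summable.of_nonneg_of_le (fun _ => norm_nonneg _) h1 ?_
  have h2 : ∀ k : ℕ, ((k : ℤ) ^ 2) = ((k ^ 2 : ℕ) : ℤ) := fun k => by push_cast; rfl
  refine Summable.of_nat_of_neg ?_ ?_
  · refine (summable_pow_mul_pow_sq (norm_nonneg t) (norm_nonneg q) hq).congr fun k => ?_
    rw [h2, zpow_natCast, zpow_natCast, norm_mul, norm_pow, norm_pow]
  · refine (summable_pow_mul_pow_sq (norm_nonneg t⁻¹) (norm_nonneg q) hq).congr fun k => ?_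
    rw [neg_sq, h2, zpow_natCast, zpow_neg, ← inv_zpow, zpow_natCast, norm_mul, norm_pow, norm_pow]

theorem isLaurent_thetaSeries {a : ℤ → ℂ} (ha : ∀ k, ‖a k‖ ≤ 1) {q : ℂ} (hq : ‖q‖ < 1) :
    IsLaurent (thetaSeries a q) := by
  refine ⟨ℤ, fun k => a k * q ^ (k ^ 2), id, fun t _ => ?_⟩
  have e : ∀ k : ℤ, a k * q ^ (k ^ 2) * t ^ id k = a k * t ^ k * q ^ (k ^ 2) := fun k => by
    rw [id, mul_right_comm]
  simp only [e]
  exact ⟨summable_thetaSeries ha hq t, rfl⟩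

theorem thetaSeries_mul {a : ℤ → ℂ} {t q : ℂ} (ht : t ≠ 0) (hq0 : q ≠ 0) :
    thetaSeries a q (t * q ^ 3) =
      (t * q)⁻¹ ^ 2 * thetaSeries (fun k => a (-k - 2)) q (q / t) := by
  have h := (Equiv.subLeft (-2 : ℤ)).tsum_eq (fun k => a k * (t * q ^ 3) ^ k * q ^ (k ^ 2))
  rw [thetaSeries, ← h, thetaSeries, ← tsum_mul_left]
  refine tsum_congr fun k => ?_
  rw [Equiv.subLeft_apply, show -2 - k = -k - 2 by ring, div_zpow, mul_zpow, ← zpow_natCast q 3,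
    ← zpow_mul, show (t * q)⁻¹ ^ 2 = t ^ (-2 : ℤ) * q ^ (-2 : ℤ) by
      rw [zpow_neg, zpow_neg, mul_inv, mul_pow]; norm_cast; simp]
  have e1 : t ^ (-k - 2) = t ^ (-2 : ℤ) * (t ^ k)⁻¹ := by
    rw [← zpow_neg, ← zpow_add₀ ht]; congr 1; ring
  have e2 : q ^ ((3 : ℕ) * (-k - 2)) * q ^ ((-k - 2) ^ 2) =
      q ^ (-2 : ℤ) * (q ^ k * q ^ (k ^ 2)) := by
    rw [← zpow_add₀ hq0, ← zpow_add₀ hq0, ← zpow_add₀ hq0]; congr 1; push_cast; ring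
  rw [e1]
  linear_combination a (-k - 2) * t ^ (-2 : ℤ) * (t ^ k)⁻¹ * e2

theorem thetaSeries_div {a : ℤ → ℂ} {t q : ℂ} (ht : t ≠ 0) (hq0 : q ≠ 0) :
    thetaSeries a q (q / (t * q ^ 3)) =
      (t * q)⁻¹ * thetaSeries (fun k => a (1 - k)) q t := by
  have h := (Equiv.subLeft (1 : ℤ)).tsum_eq (fun k => a k * (q / (t * q ^ 3)) ^ k * q ^ (k ^ 2))
  rw [thetaSeries, ← h, thetaSeries, ← tsum_mul_left]
  refine tsum_congr fun k => ?_
  rw [Equiv.subLeft_apply, show q / (t * q ^ 3) = t⁻¹ * q ^ (-2 : ℤ) by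
    rw [zpow_neg]; norm_cast; field_simp, mul_zpow, ← zpow_mul, inv_zpow, mul_inv]
  have e1 : (t ^ (1 - k))⁻¹ = t⁻¹ * t ^ k := by
    rw [← zpow_neg, ← zpow_neg_one, ← zpow_add₀ ht]; congr 1; ring
  have e2 : q ^ (-2 * (1 - k)) * q ^ ((1 - k) ^ 2) = q⁻¹ * q ^ (k ^ 2) := by
    rw [← zpow_neg_one, ← zpow_add₀ hq0, ← zpow_add₀ hq0]; congr 1; ring
  rw [e1]
  linear_combination a (1 - k) * t⁻¹ * t ^ k * e2

/-! ### The series at `t ^ 2 = q` -/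

/-- The coefficients `χ₃(k)`, multiplied by `δ` for negative `k`: for `δ = 1` they give a theta
function, for `δ = -1` a false theta function, and for `δ = 0` a partial theta function. -/
noncomputable def chiCoeff (δ : ℂ) (k : ℤ) : ℂ := if 0 ≤ k then (chi3 k : ℂ) else δ * chi3 k

theorem norm_chiCoeff_le {δ : ℂ} (hδ : ‖δ‖ ≤ 1) (k : ℤ) : ‖chiCoeff δ k‖ ≤ 1 := by
  unfold chiCoeff
  split_ifs
  · exact norm_chi3_le k
  · rw [norm_mul]
    exact mul_le_one₀ hδ (norm_nonneg _) (norm_chi3_le k)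

theorem tsum_mod_three {f : ℕ → ℂ} (hf : Summable f) :
    ∑' n, f n = ∑' n, f (3 * n) + ∑' n, f (3 * n + 1) + ∑' n, f (3 * n + 2) := by
  rw [Nat.sumByResidueClasses hf 3]
  change ∑ j : Fin 3, ∑' m : ℕ, f (j.val + 3 * m) = _
  rw [Fin.sum_univ_three]
  simp only [Fin.val_zero, Fin.val_one, Fin.val_two, zero_add, add_comm]

theorem tsum_even_add_odd' {f : ℕ → ℂ} (hf : Summable f) :
    ∑' n, f n = ∑' n, f (2 * n) + ∑' n, f (2 * n + 1) := by
  have h1 : Summable fun n => f (2 * n) :=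
    hf.comp_injective (i := fun n => 2 * n) fun a b h => by simpa using h
  have h2 : Summable fun n => f (2 * n + 1) :=
    hf.comp_injective (i := fun n => 2 * n + 1) fun a b h => by simpa using h
  exact (tsum_even_add_odd (f := f) h1 h2).symm

theorem pent_even (n : ℕ) : 2 * n * (3 * (2 * n) + 1) / 2 = n * (6 * n + 1) := by
  rw [show 2 * n * (3 * (2 * n) + 1) = 2 * (n * (6 * n + 1)) by ring]
  exact Nat.mul_div_cancel_left _ (by norm_num)

theorem pent_odd (n : ℕ) :
    (2 * n + 1) * (3 * (2 * n + 1) + 1) / 2 = (2 * n + 1) * (3 * n + 2) := by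
  rw [show (2 * n + 1) * (3 * (2 * n + 1) + 1) = 2 * ((2 * n + 1) * (3 * n + 2)) by ring]
  exact Nat.mul_div_cancel_left _ (by norm_num)

/-- At `t ^ 2 = q` the exponents `k (2 k + 1)` of `t` with `χ₃(k) ≠ 0` are three times the
generalized pentagonal numbers. -/
theorem thetaSeries_of_sq {δ t q : ℂ} (hδ : ‖δ‖ ≤ 1) (ht : t ≠ 0) (htq : t ^ 2 = q)
    (hq : ‖q‖ < 1) :
    thetaSeries (chiCoeff δ) q t =
      ∑' n, pentTerm (t ^ 3) (2 * n) - δ * ∑' n, pentTerm (t ^ 3) (2 * n + 1) := by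
  have hy := norm_pow_three_lt_one (norm_lt_one_of_sq htq hq)
  have hsp := (summable_norm_pentTerm hy).of_norm
  set F : ℤ → ℂ := fun k => chiCoeff δ k * t ^ k * q ^ (k ^ 2) with hF
  have hs : Summable F := (summable_thetaSeries (norm_chiCoeff_le hδ) hq t).of_norm
  have hFk : ∀ k : ℤ, F k = chiCoeff δ k * t ^ (k + 2 * k ^ 2) := fun k => by
    change chiCoeff δ k * t ^ k * q ^ (k ^ 2) = _
    rw [zpow_add₀ ht, zpow_mul, ← htq, mul_assoc]
    norm_cast
  have hinj1 : Function.Injective fun n : ℕ => (n : ℤ) := Nat.cast_injective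
  have hinj2 : Function.Injective fun n : ℕ => -((n : ℤ) + 1) := fun a b h => by
    have : -((a : ℤ) + 1) = -((b : ℤ) + 1) := h
    omega
  have s1 : Summable fun n : ℕ => F n := hs.comp_injective hinj1
  have s2 : Summable fun n : ℕ => F (-((n : ℤ) + 1)) := hs.comp_injective hinj2
  have hsplit : thetaSeries (chiCoeff δ) q t =
      ∑' n : ℕ, F n + ∑' n : ℕ, F (-((n : ℤ) + 1)) :=
    (HasSum.of_nat_of_neg_add_one s1.hasSum s2.hasSum).tsum_eq
  have hsub : ∀ {f : ℕ → ℂ}, Summable f → ∀ j : ℕ, Summable fun n => f (3 * n + j) :=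
    fun {f} hf j => hf.comp_injective (i := fun n => 3 * n + j) fun a b h => by simpa using h
  have c0 : ∀ n : ℕ, chiCoeff δ ((3 * n : ℕ) : ℤ) = 1 := fun n => by
    rw [chiCoeff, if_pos (by positivity), chi3_eq, if_pos (by push_cast; omega)]
    norm_num
  have c1 : ∀ n : ℕ, chiCoeff δ ((3 * n + 1 : ℕ) : ℤ) = -1 := fun n => by
    rw [chiCoeff, if_pos (by positivity), chi3_eq, if_neg (by push_cast; omega),
      if_pos (by push_cast; omega)]
    norm_num
  have c2 : ∀ n : ℕ, chiCoeff δ ((3 * n + 2 : ℕ) : ℤ) = 0 := fun n => by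
    rw [chiCoeff, if_pos (by positivity), chi3_eq, if_neg (by push_cast; omega),
      if_neg (by push_cast; omega)]
    norm_num
  have d0 : ∀ n : ℕ, chiCoeff δ (-(((3 * n : ℕ) : ℤ) + 1)) = 0 := fun n => by
    rw [chiCoeff, if_neg (by push_cast; omega), chi3_eq, if_neg (by push_cast; omega),
      if_neg (by push_cast; omega)]
    norm_num
  have d1 : ∀ n : ℕ, chiCoeff δ (-(((3 * n + 1 : ℕ) : ℤ) + 1)) = -δ := fun n => by
    rw [chiCoeff, if_neg (by push_cast; omega), chi3_eq, if_neg (by push_cast; omega),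
      if_pos (by push_cast; omega)]
    norm_num
  have d2 : ∀ n : ℕ, chiCoeff δ (-(((3 * n + 2 : ℕ) : ℤ) + 1)) = δ := fun n => by
    rw [chiCoeff, if_neg (by push_cast; omega), chi3_eq, if_pos (by push_cast; omega)]
    norm_num
  have hp1 : ∑' n : ℕ, F n = ∑' n, pentTerm (t ^ 3) (2 * n) := by
    have hsub0 : Summable fun n : ℕ => F ((3 * n : ℕ) : ℤ) := by simpa using hsub s1 0
    rw [tsum_mod_three s1]
    have h2 : ∑' n : ℕ, F ((3 * n + 2 : ℕ) : ℤ) = 0 := by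
      rw [← tsum_zero (β := ℕ)]
      exact tsum_congr fun n => by rw [hFk, c2, zero_mul]
    rw [h2, add_zero, ← hsub0.tsum_add (hsub s1 1)]
    refine tsum_congr fun n => ?_
    rw [hFk, hFk, c0, c1, pentTerm, pent_even, ← pow_mul, ← pow_mul, mul_sub, ← pow_add,
      mul_one]
    have e1 : ((3 * n : ℕ) : ℤ) + 2 * ((3 * n : ℕ) : ℤ) ^ 2 =
        ((3 * (n * (6 * n + 1)) : ℕ) : ℤ) := by
      push_cast; ring
    have e2 : ((3 * n + 1 : ℕ) : ℤ) + 2 * ((3 * n + 1 : ℕ) : ℤ) ^ 2 =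
        ((3 * (n * (6 * n + 1)) + 3 * (2 * (2 * n) + 1) : ℕ) : ℤ) := by
      push_cast; ring
    rw [e1, e2, zpow_natCast, zpow_natCast]
    ring
  have hp2 : ∑' n : ℕ, F (-((n : ℤ) + 1)) = -δ * ∑' n, pentTerm (t ^ 3) (2 * n + 1) := by
    rw [tsum_mod_three s2]
    have h2 : ∑' n : ℕ, F (-(((3 * n : ℕ) : ℤ) + 1)) = 0 := by
      rw [← tsum_zero (β := ℕ)]
      exact tsum_congr fun n => by rw [hFk, d0, zero_mul]
    rw [h2, zero_add, ← (hsub s2 1).tsum_add (hsub s2 2), ← tsum_mul_left]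
    refine tsum_congr fun n => ?_
    rw [hFk, hFk, d1, d2, pentTerm, pent_odd, ← pow_mul, ← pow_mul, mul_sub, ← pow_add, mul_one]
    have e1 : -(((3 * n + 1 : ℕ) : ℤ) + 1) + 2 * (-(((3 * n + 1 : ℕ) : ℤ) + 1)) ^ 2 =
        ((3 * ((2 * n + 1) * (3 * n + 2)) : ℕ) : ℤ) := by
      push_cast; ring
    have e2 : -(((3 * n + 2 : ℕ) : ℤ) + 1) + 2 * (-(((3 * n + 2 : ℕ) : ℤ) + 1)) ^ 2 =
        ((3 * ((2 * n + 1) * (3 * n + 2)) + 3 * (2 * (2 * n + 1) + 1) : ℕ) : ℤ) := by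
      push_cast; ring
    rw [e1, e2, zpow_natCast, zpow_natCast]
    ring
  rw [hsplit, hp1, hp2]
  ring

/-- **Euler's pentagonal number theorem**. -/
theorem qFac_self_eq {y : ℂ} (hy : ‖y‖ < 1) : qFac y y = ∑' n, (-1) ^ n * pentTerm y n := by
  have hprod : ∀ k n : ℕ, ‖∏ i ∈ Finset.range n, (1 - y ^ (k + i + 1))‖ ≤
      Real.exp (1 - ‖y‖)⁻¹ := by
    intro k n
    rw [norm_prod]
    calc ∏ i ∈ Finset.range n, ‖1 - y ^ (k + i + 1)‖
        ≤ ∏ i ∈ Finset.range n, Real.exp (‖y‖ ^ i) := by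
          refine Finset.prod_le_prod (fun _ _ => norm_nonneg _) fun i _ => ?_
          refine (norm_sub_le _ _).trans ?_
          rw [norm_one, norm_pow, add_comm]
          refine le_trans ?_ (Real.add_one_le_exp _)
          gcongr ?_ + 1
          exact pow_le_pow_of_le_one (norm_nonneg _) hy.le (by omega)
      _ = Real.exp (∑ i ∈ Finset.range n, ‖y‖ ^ i) := (Real.exp_sum _ _).symm
      _ ≤ Real.exp (1 - ‖y‖)⁻¹ := by
          refine Real.exp_le_exp.2 ?_
          rw [← tsum_geometric_of_lt_one (norm_nonneg y) hy]
          exact (summable_geometric_of_lt_one (norm_nonneg y) hy).sum_le_tsum _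
            fun i _ => by positivity
  set K := Real.exp (1 - ‖y‖)⁻¹ with hK
  have hterm : ∀ k n : ℕ, ‖y ^ ((k + 1) * n) * ∏ i ∈ Finset.range (n + 1), (1 - y ^ (k + i + 1))‖ ≤
      ‖y‖ ^ n * K := by
    intro k n
    rw [norm_mul, norm_pow]
    exact mul_le_mul (pow_le_pow_of_le_one (norm_nonneg _) hy.le
      (Nat.le_mul_of_pos_left n (Nat.succ_pos k))) (hprod k (n + 1)) (norm_nonneg _)
      (pow_nonneg (norm_nonneg _) n)
  have hgeo : Summable fun n : ℕ => ‖y‖ ^ n * K :=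
    (summable_geometric_of_lt_one (norm_nonneg y) hy).mul_right K
  have h1 : ∀ k : ℕ, (k * (3 * k + 1) / 2 : ℕ) = pentagonal (-k) := fun k => by
    refine Nat.div_eq_of_eq_mul_right two_pos ?_
    zify
    exact (two_mul_natCast_pentagonal_neg k).symm
  have h2 : ∀ k : ℕ, ((k + 1) * (3 * k + 2) / 2 : ℕ) = pentagonal (k + 1) := fun k => by
    refine Nat.div_eq_of_eq_mul_right two_pos ?_
    zify
    rw [two_mul_natCast_pentagonal]
    ring
  have h3 : ∀ k : ℕ, (k + 1) * (3 * k + 2) / 2 = k * (3 * k + 1) / 2 + (2 * k + 1) := fun k => by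
    rw [show (k + 1) * (3 * k + 2) = k * (3 * k + 1) + 2 * (2 * k + 1) by ring,
      Nat.add_mul_div_left _ _ (by norm_num)]
  have h4 : ∀ k : ℕ, (-1) ^ k * pentTerm y k =
      (-1) ^ k * (y ^ pentagonal (-k) - y ^ pentagonal (k + 1)) := fun k => by
    rw [← h1, ← h2, h3, pentTerm, pow_add]
    ring
  have hsum : ∀ k : ℕ, Summable fun n : ℕ =>
      y ^ ((k + 1) * n) * ∏ i ∈ Finset.range (n + 1), (1 - y ^ (k + i + 1)) := fun k =>
    Summable.of_norm_bounded hgeo (hterm k)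
  have hlhs : ∀ k : ℕ, Multipliable fun n : ℕ => 1 - y ^ (n + k + 1) := fun k =>
    (multipliable_congr fun n => by rw [← pow_add, show k + 1 + n = n + k + 1 by ring]).1
      (multipliable_qFac (y ^ (k + 1)) hy)
  have hrhs : Summable fun k : ℕ =>
      (-1) ^ k * (y ^ pentagonal (-k) - y ^ pentagonal (k + 1)) := by
    refine Summable.of_norm ((summable_norm_pentTerm hy).congr fun k => ?_)
    rw [← h4, norm_mul, norm_pow, norm_neg, norm_one, one_pow, one_mul]
  have htail : Tendsto (fun k : ℕ => (-1) ^ (k + 1) * y ^ ((k + 1) * (3 * k + 4) / 2) *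
      ∑' n : ℕ, y ^ ((k + 1) * n) * ∏ i ∈ Finset.range (n + 1), (1 - y ^ (k + i + 1)))
      atTop (𝓝 0) := by
    refine squeeze_zero_norm (a := fun k : ℕ => ‖y‖ ^ k * ∑' n : ℕ, ‖y‖ ^ n * K) (fun k => ?_) ?_
    · rw [norm_mul, norm_mul, norm_pow, norm_neg, norm_one, one_pow, one_mul, norm_pow]
      refine mul_le_mul (pow_le_pow_of_le_one (norm_nonneg _) hy.le ?_)
        (tsum_of_norm_bounded hgeo.hasSum (hterm k)) (norm_nonneg _) (pow_nonneg (norm_nonneg _) k)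
      rw [Nat.le_div_iff_mul_le (by norm_num)]
      nlinarith [Nat.zero_le k]
    · simpa using (tendsto_pow_atTop_nhds_zero_of_lt_one (norm_nonneg y) hy).mul_const
        (∑' n : ℕ, ‖y‖ ^ n * K)
  have h := Pentagonal.tprod_one_sub_pow (x := y) (tendsto_pow_atTop_nhds_zero_of_norm_lt_one hy)
    hsum hlhs hrhs htail
  rw [qFac, tsum_congr h4, ← h]
  exact tprod_congr fun j => by rw [pow_succ']

theorem thetaSeries_false_of_sq {t q : ℂ} (ht : t ≠ 0) (htq : t ^ 2 = q) (hq : ‖q‖ < 1) :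
    thetaSeries (chiCoeff (-1)) q t = ∑' n, pentTerm (t ^ 3) n := by
  have hy := norm_pow_three_lt_one (norm_lt_one_of_sq htq hq)
  rw [thetaSeries_of_sq (by simp) ht htq hq,
    tsum_even_add_odd' (summable_norm_pentTerm hy).of_norm]
  ring

theorem thetaSeries_true_of_sq {t q : ℂ} (ht : t ≠ 0) (htq : t ^ 2 = q) (hq : ‖q‖ < 1) :
    thetaSeries (chiCoeff 1) q t = qFac (t ^ 3) (t ^ 3) := by
  have hy := norm_pow_three_lt_one (norm_lt_one_of_sq htq hq)
  have hs : Summable fun n => (-1) ^ n * pentTerm (t ^ 3) n := by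
    refine Summable.of_norm ((summable_norm_pentTerm hy).congr fun k => ?_)
    rw [norm_mul, norm_pow, norm_neg, norm_one, one_pow, one_mul]
  rw [thetaSeries_of_sq (by simp) ht htq hq, qFac_self_eq hy, tsum_even_add_odd' hs, one_mul,
    sub_eq_add_neg, ← tsum_neg]
  congr 1 <;> refine tsum_congr fun n => ?_
  · rw [pow_mul (-1 : ℂ), neg_one_sq, one_pow, one_mul]
  · rw [pow_succ (-1 : ℂ), pow_mul (-1 : ℂ), neg_one_sq, one_pow, one_mul, neg_one_mul]

/-! ### The functional equations of the series -/

/-- The reflection `k ↦ -k - 2` exchanges the nonnegative and the negative integers up to `-1`,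
where `χ₃` vanishes. -/
theorem chiCoeff_neg_sub_two {δ : ℂ} (hδ : δ ^ 2 = 1) (k : ℤ) :
    chiCoeff δ (-k - 2) = -δ * chiCoeff δ k := by
  have h3 : k % 3 = 0 ∨ k % 3 = 1 ∨ k % 3 = 2 := by omega
  unfold chiCoeff
  rw [chi3_eq, chi3_eq]
  rcases h3 with h | h | h
  · rw [if_neg (show ¬ (-k - 2) % 3 = 0 by omega), if_pos (show (-k - 2) % 3 = 1 by omega),
      if_pos h]
    split_ifs with h1 h2 h2
    · omega
    · push_cast; linear_combination hδ
    · push_cast; ring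
    · omega
  · rw [if_pos (show (-k - 2) % 3 = 0 by omega), if_neg (show ¬ k % 3 = 0 by omega), if_pos h]
    split_ifs with h1 h2 h2
    · omega
    · push_cast; linear_combination -hδ
    · push_cast; ring
    · omega
  · rw [if_neg (show ¬ (-k - 2) % 3 = 0 by omega), if_neg (show ¬ (-k - 2) % 3 = 1 by omega),
      if_neg (show ¬ k % 3 = 0 by omega), if_neg (show ¬ k % 3 = 1 by omega)]
    simp

theorem thetaSeries_chiCoeff_mul {δ t q : ℂ} (hδ : δ ^ 2 = 1) (ht : t ≠ 0) (hq0 : q ≠ 0) :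
    thetaSeries (chiCoeff δ) q (t * q ^ 3) =
      -δ * (t * q)⁻¹ ^ 2 * thetaSeries (chiCoeff δ) q (q / t) := by
  rw [thetaSeries_mul ht hq0, mul_comm (-δ), mul_assoc]
  congr 1
  rw [thetaSeries, thetaSeries, ← tsum_mul_left]
  exact tsum_congr fun k => by rw [chiCoeff_neg_sub_two hδ]; ring

theorem chi3_one_sub (k : ℤ) : chi3 (1 - k) = -chi3 k := by
  rw [chi3_eq, chi3_eq]
  split_ifs <;> omega

theorem thetaSeries_true_div {t q : ℂ} (ht : t ≠ 0) (hq0 : q ≠ 0) :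
    thetaSeries (chiCoeff 1) q (q / (t * q ^ 3)) =
      -(t * q)⁻¹ * thetaSeries (chiCoeff 1) q t := by
  rw [thetaSeries_div ht hq0, neg_mul, ← mul_neg]
  congr 1
  rw [thetaSeries, thetaSeries, ← tsum_neg]
  refine tsum_congr fun k => ?_
  have h : ∀ m, chiCoeff 1 m = chi3 m := fun m => by simp [chiCoeff]
  rw [h, h, chi3_one_sub]
  push_cast
  ring

/-- The reflection `k ↦ 1 - k` exchanges the nonnegative and the negative integers up to the
integers `0` and `1`, which contribute the two additional terms. -/
theorem thetaSeries_false_div {t q : ℂ} (ht : t ≠ 0) (hq0 : q ≠ 0) (hq : ‖q‖ < 1) :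
    thetaSeries (chiCoeff (-1)) q (q / (t * q ^ 3)) =
      (t * q)⁻¹ * thetaSeries (chiCoeff (-1)) q t - 2 * (t * q)⁻¹ + 2 := by
  have h1 : ∀ k : ℤ, chiCoeff (-1) (1 - k) = chiCoeff (-1) k +
      ((if k = 0 then -2 else 0) + if k = 1 then 2 else 0) := by
    intro k
    by_cases hk0 : k = 0
    · subst hk0
      norm_num [chiCoeff, chi3_eq]
    by_cases hk1 : k = 1
    · subst hk1
      norm_num [chiCoeff, chi3_eq]
    rw [if_neg hk0, if_neg hk1, add_zero, add_zero, chiCoeff, chiCoeff, chi3_one_sub]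
    split_ifs
    · omega
    · push_cast; ring
    · push_cast; ring
    · omega
  have hs := (summable_thetaSeries (norm_chiCoeff_le (δ := -1) (by simp)) hq t).of_norm
  have h2 : HasSum (fun k : ℤ => (if k = 0 then -2 else 0 : ℂ)) (-2) := hasSum_ite_eq 0 (-2)
  have h3 : HasSum (fun k : ℤ => (if k = 1 then 2 * (t * q) else 0 : ℂ)) (2 * (t * q)) :=
    hasSum_ite_eq 1 (2 * (t * q))
  have h4 : thetaSeries (fun k => chiCoeff (-1) (1 - k)) q t =
      thetaSeries (chiCoeff (-1)) q t + (-2 + 2 * (t * q)) := by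
    refine HasSum.tsum_eq ?_
    convert! hs.hasSum.add (h2.add h3) using 2 with k
    beta_reduce
    rw [h1]
    by_cases hk0 : k = 0
    · subst hk0
      simp
    by_cases hk1 : k = 1
    · subst hk1
      simp
      ring
    simp [hk0, hk1]
  rw [thetaSeries_div ht hq0, h4]
  field_simp
  ring

/-! ### Laurent series that are quasi-periodic of order two -/

/-- `θ(c t ^ 2; q ^ 6)` is quasi-periodic of order two with multiplier `q ^ 3`. -/
theorem theta_sq_mul {c t q : ℂ} (hc : c ≠ 0) (ht : t ≠ 0) (hq0 : q ≠ 0) (hq : ‖q‖ < 1) :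
    theta (c * (t * q ^ 3) ^ 2) (q ^ 6) = (c * t ^ 2)⁻¹ * theta (c * t ^ 2) (q ^ 6) := by
  rw [show c * (t * q ^ 3) ^ 2 = c * t ^ 2 * q ^ 6 by ring]
  exact theta_mul (mul_ne_zero hc (pow_ne_zero 2 ht)) (pow_ne_zero 6 hq0)
    (norm_pow_lt_one hq (by norm_num))

theorem isLaurent_theta_sq {c q : ℂ} (hc : c ≠ 0) (hq0 : q ≠ 0) (hq : ‖q‖ < 1) :
    IsLaurent fun t => theta (c * t ^ 2) (q ^ 6) :=
  ((isLaurent_theta (pow_ne_zero 6 hq0) (norm_pow_lt_one hq (by norm_num))).comp_mul_zpow hc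
    2).congr fun t _ => by norm_cast

theorem neg_mul_pow_ne_one {q : ℂ} (hq : ‖q‖ < 1) {m : ℕ} (hm : m ≠ 0) (j : ℕ) :
    -q ^ m * (q ^ 6) ^ j ≠ 1 :=
  mul_pow_ne_one (by rw [norm_neg]; exact norm_pow_lt_one hq hm)
    (norm_pow_lt_one hq (by norm_num)) j

/-- A solution of `t ^ 2 f(t q ^ 3) = q⁻² f(t)` is determined by its values at the two square roots
of `q`: its even part is a multiple of `θ(t ^ 2 q ^ 2; q ^ 6)`, and its odd part is a multiple of
`t θ(t ^ 2 q ^ 5; q ^ 6)`. -/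
theorem IsLaurent.eq_zero_of_eq_zero_sqrt {f : ℂ → ℂ} (hf : IsLaurent f) {q : ℂ} (hq0 : q ≠ 0)
    (hq : ‖q‖ < 1) (hfP : ∀ t, t ≠ 0 → t ^ 2 * f (t * q ^ 3) = (q ^ 2)⁻¹ * f t)
    (h0 : ∀ r, r ≠ 0 → r ^ 2 = q → f r = 0) {t : ℂ} (ht : t ≠ 0) : f t = 0 := by
  obtain ⟨r, hr0, hr⟩ := exists_sq_eq hq0
  have hr1 : f r = 0 := h0 r hr0 hr
  have hr2 : f (-r) = 0 := h0 (-r) (neg_ne_zero.2 hr0) (by rw [neg_sq, hr])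
  have hQ : ‖q ^ 6‖ < 1 := norm_pow_lt_one hq (by norm_num)
  have hq3 : q ^ 3 ≠ 0 := pow_ne_zero 3 hq0
  have hC : (q ^ 2)⁻¹ ≠ 0 := inv_ne_zero (pow_ne_zero 2 hq0)
  have hfN : ∀ t, t ≠ 0 → t ^ 2 * f (-(t * q ^ 3)) = (q ^ 2)⁻¹ * f (-t) := fun t ht => by
    rw [← hfP (-t) (neg_ne_zero.2 ht), neg_sq, neg_mul]
  have hθ0 : theta (q ^ 2 * r ^ 2) (q ^ 6) ≠ 0 := by
    rw [hr, show q ^ 2 * q = q ^ 3 by ring]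
    refine theta_ne_zero hQ (neg_mul_pow_ne_one hq three_ne_zero) ?_
    rw [show -(q ^ 3)⁻¹ * q ^ 6 = -q ^ 3 by field_simp]
    exact neg_mul_pow_ne_one hq three_ne_zero
  have hθ1 : theta (q ^ 5 * r ^ 2) (q ^ 6) ≠ 0 := by
    rw [hr, show q ^ 5 * q = q ^ 6 by ring]
    refine theta_ne_zero hQ (neg_mul_pow_ne_one hq (by norm_num)) fun j => ?_
    rw [neg_mul, inv_mul_cancel₀ (pow_ne_zero 6 hq0)]
    -- For `j = 0` the factor is `1 + 1`, and for `j > 0` the power has norm less than one.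
    rcases Nat.eq_zero_or_pos j with rfl | hj
    · norm_num
    · intro h
      have h1 := norm_pow_lt_one hQ hj.ne'
      rw [← norm_neg, ← neg_one_mul, h, norm_one] at h1
      exact lt_irrefl _ h1
  have he : f t + f (-t) = 0 := by
    refine (hf.add hf.comp_neg).eq_zero_of_quasiperiodic_two
      (isLaurent_theta_sq (pow_ne_zero 2 hq0) hq0 hq) hq3 hC
      (fun t ht => by rw [mul_add, hfP t ht, hfN t ht, mul_add]) (fun t ht => ?_) 0
      (fun t _ => by rw [neg_neg]; ring) (fun t _ => by rw [neg_sq]; ring) hr0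
      (by rw [hr1, hr2, add_zero]) hθ0 ht
    rw [theta_sq_mul (pow_ne_zero 2 hq0) ht hq0 hq]
    field_simp
  have ho : f t - f (-t) = 0 := by
    refine (hf.sub hf.comp_neg).eq_zero_of_quasiperiodic_two
      (isLaurent_id.mul (isLaurent_theta_sq (pow_ne_zero 5 hq0) hq0 hq)) hq3 hC
      (fun t ht => by rw [mul_sub, hfP t ht, hfN t ht, mul_sub]) (fun t ht => ?_) 1
      (fun t _ => by rw [neg_neg]; ring) (fun t _ => by rw [neg_sq]; ring) hr0
      (by rw [hr1, hr2, sub_zero]) (mul_ne_zero hr0 hθ1) ht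
    rw [theta_sq_mul (pow_ne_zero 5 hq0) ht hq0 hq]
    field_simp
  linear_combination (he + ho) / 2

/-- The symmetry `f(q / t) = f(t)` forces the odd coefficients of a solution of
`t ^ 2 f(t q ^ 3) = -q⁻² f(t)` to vanish, so that the solution is a multiple of
`θ(-t ^ 2 q ^ 2; q ^ 6)`. -/
theorem IsLaurent.eq_zero_of_symm {f : ℂ → ℂ} (hf : IsLaurent f) {q : ℂ} (hq0 : q ≠ 0)
    (hq : ‖q‖ < 1) (hfP : ∀ t, t ≠ 0 → t ^ 2 * f (t * q ^ 3) = -(q ^ 2)⁻¹ * f t)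
    (hfs : ∀ t, t ≠ 0 → f (q / t) = f t) {r : ℂ} (hr0 : r ≠ 0)
    (hθ : theta (-q ^ 2 * r ^ 2) (q ^ 6) ≠ 0) (hr : f r = 0) {t : ℂ} (ht : t ≠ 0) : f t = 0 := by
  have hq2 : -q ^ 2 ≠ 0 := neg_ne_zero.2 (pow_ne_zero 2 hq0)
  have hq3 : q ^ 3 ≠ 0 := pow_ne_zero 3 hq0
  have hC : -(q ^ 2)⁻¹ ≠ 0 := neg_ne_zero.2 (inv_ne_zero (pow_ne_zero 2 hq0))
  obtain ⟨c, hc⟩ := hf.exists_hasLaurent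
  obtain ⟨e, he⟩ := (isLaurent_theta_sq hq2 hq0 hq).exists_hasLaurent
  have hrec := hc.coeff_rec hq3 (N := 2) hfP
  have h1 : c 1 = 0 := by
    have h2 := (hc.comp_div hq0).unique hc hfs 1
    have h3 := hrec (-1)
    norm_num at h2 h3
    field_simp at h2 h3
    have h4 : 2 * (c 1 * q) = 0 := by linear_combination h3 - h2
    simpa [hq0] using h4
  refine hc.eq_zero_of_quasiperiodic he hq3 hC (N := 2) (j := 0) hfP (fun t ht => ?_)
    (fun n hn => ?_) (he.coeff_eq_zero_of_parity fun t _ => by rw [neg_sq]; ring) hr0 hr hθ ht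
  · rw [theta_sq_mul hq2 ht hq0 hq]
    field_simp
  · obtain ⟨k, rfl⟩ : ∃ k, n = 1 + (2 : ℕ) * k := by
      have h2 : n % 2 = 0 ∨ n % 2 = 1 := by omega
      rcases h2 with h | h
      · exact absurd (by push_cast; omega) (hn (n / 2))
      · exact ⟨n / 2, by push_cast; omega⟩
    exact coeff_eq_zero hq3 hC hrec h1 k

/-! ### The two bilinear identities -/

/-- The function `C₃` in terms of a false theta function. The difference of the two sides is
quasi-periodic, as the inhomogeneous terms from `gapSum_three_shift` and `thetaSeries_false_div`
cancel, and it vanishes at the square roots of `q` by the identity `falseSum_zero` of Rogers. -/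
theorem two_mul_gapSum_three {t q : ℂ} (ht : t ≠ 0) (hq0 : q ≠ 0) (hq : ‖q‖ < 1) :
    2 * gapSum t q 3 = gapSum t q 2 * thetaSeries (chiCoeff (-1)) q (q / t) +
      gapSumStar t q * thetaSeries (chiCoeff (-1)) q t := by
  have hδ : ‖(-1 : ℂ)‖ ≤ 1 := by simp
  have hF := isLaurent_thetaSeries (norm_chiCoeff_le hδ) hq
  have hL := ((isLaurent_gapSum hq 3).const_mul 2).sub
    (((isLaurent_gapSum hq 2).mul (hF.comp_div hq0)).add ((isLaurent_gapSumStar hq).mul hF))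
  refine sub_eq_zero.1 (hL.eq_zero_of_eq_zero_sqrt hq0 hq (fun t ht => ?_)
    (fun r hr0 hr => ?_) ht)
  · rw [gapSum_three_shift ht hq0 hq, gapSum_two_shift ht hq0 hq, gapSumStar_shift ht hq0 hq,
      thetaSeries_false_div ht hq0 hq, thetaSeries_chiCoeff_mul (by norm_num) ht hq0]
    field_simp
    ring
  · have e : q / r = r := by rw [← hr]; field_simp
    rw [e, gapSum_three_of_sq hr0 hr hq, gapSumStar_of_sq hr0 hr hq,
      thetaSeries_false_of_sq hr0 hr hq]
    ring

/-- The companion of `two_mul_gapSum_three` with theta functions in place of false theta functions;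
at a square root of `q` it reduces to the pentagonal number theorem. -/
theorem two_mul_theta {t q : ℂ} (ht : t ≠ 0) (hq0 : q ≠ 0) (hq : ‖q‖ < 1) :
    2 * (qFac (-q ^ 3) (q ^ 3) * theta (-t ^ 2 * q ^ 2) (q ^ 6)) =
      gapSum t q 2 * thetaSeries (chiCoeff 1) q (q / t) +
        gapSumStar t q * thetaSeries (chiCoeff 1) q t := by
  have hδ : ‖(1 : ℂ)‖ ≤ 1 := by simp
  have hp := norm_pow_three_lt_one hq
  have hq2 : -q ^ 2 ≠ 0 := neg_ne_zero.2 (pow_ne_zero 2 hq0)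
  have hF := isLaurent_thetaSeries (norm_chiCoeff_le hδ) hq
  have hL := (((isLaurent_theta_sq hq2 hq0 hq).const_mul (qFac (-q ^ 3) (q ^ 3))).const_mul 2).sub
    (((isLaurent_gapSum hq 2).mul (hF.comp_div hq0)).add ((isLaurent_gapSumStar hq).mul hF))
  obtain ⟨r, hr0, hr⟩ := exists_sq_eq hq0
  have hr1 := norm_lt_one_of_sq hr hq
  have hy := norm_pow_three_lt_one hr1
  have e1 : -q ^ 2 * r ^ 2 = -(r ^ 3) ^ 2 := by rw [← hr]; ring
  have e2 : q ^ 6 = (r ^ 3) ^ 4 := by rw [← hr]; ring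
  have e3 : (r ^ 3) ^ 2 = q ^ 3 := by rw [← hr]; ring
  have hval : theta (-q ^ 2 * r ^ 2) (q ^ 6) = qFac (-r ^ 3) (q ^ 3) * qFac (r ^ 3) (r ^ 3) := by
    rw [e1, e2, theta_neg_sq (pow_ne_zero 3 hr0) hy, e3]
  rw [show -t ^ 2 * q ^ 2 = -q ^ 2 * t ^ 2 by ring]
  refine sub_eq_zero.1 (hL.eq_zero_of_symm hq0 hq (fun t ht => ?_) (fun t ht => ?_) hr0 ?_ ?_ ht)
  · rw [gapSum_two_shift ht hq0 hq, gapSumStar_shift ht hq0 hq, theta_sq_mul hq2 ht hq0 hq,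
      thetaSeries_true_div ht hq0, thetaSeries_chiCoeff_mul (by norm_num) ht hq0]
    field_simp
    ring
  · have e4 : -q ^ 2 * (q / t) ^ 2 * (q ^ 2) = q ^ 6 / (-q ^ 2 * t ^ 2) * q ^ 2 := by
      field_simp
    have e5 := mul_right_cancel₀ (pow_ne_zero 2 hq0) e4
    rw [gapSum_two_div ht hq0 hq, gapSumStar_div ht hq0 hq, div_div_cancel₀ hq0, e5,
      theta_div (pow_ne_zero 6 hq0)]
    ring
  · rw [hval]
    exact mul_ne_zero (qFac_ne_zero_of_norm_lt (by rwa [norm_neg]) hp) (qFac_self_ne_zero hy)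
  · have e : q / r = r := by rw [← hr]; field_simp
    rw [e, gapSumStar_of_sq hr0 hr hq, gapSum_two_of_sq hr0 hr hq,
      thetaSeries_true_of_sq hr0 hr hq, hval]
    ring

/-! ### The series `Θ₁` and `Θ₂` -/

theorem summable_term2 (t : ℂ) {q : ℂ} (hq : ‖q‖ < 1) : Summable (term2 t q) := by
  refine Summable.of_norm_bounded
    (summable_pow_mul_pow_sq (norm_nonneg t) (norm_nonneg q) hq) fun k => ?_
  rw [term2, norm_mul, norm_mul, norm_pow, norm_pow, mul_assoc]
  exact mul_le_of_le_one_left (by positivity) (norm_chi3_le k)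

theorem term1_eq_term2 {q : ℂ} (t : ℂ) (k : ℕ) : term1 t q k = term2 (q / t) q k := by
  rw [term1, term2, div_pow, zpow_neg, zpow_natCast, div_eq_mul_inv]
  ring

theorem Theta1_eq_Theta2 (t q : ℂ) : Theta1 t q = Theta2 (q / t) q :=
  tsum_congr fun k => term1_eq_term2 t k

/-- A partial theta function is the mean of a theta function and a false theta function. -/
theorem two_mul_Theta2 (t : ℂ) {q : ℂ} (hq : ‖q‖ < 1) :
    2 * Theta2 t q = thetaSeries (chiCoeff 1) q t + thetaSeries (chiCoeff (-1)) q t := by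
  have h1 := (summable_thetaSeries (norm_chiCoeff_le (δ := 1) (by simp)) hq t).of_norm
  have h2 := (summable_thetaSeries (norm_chiCoeff_le (δ := -1) (by simp)) hq t).of_norm
  have h3 : ∀ k : ℤ, chiCoeff 1 k * t ^ k * q ^ (k ^ 2) + chiCoeff (-1) k * t ^ k * q ^ (k ^ 2) =
      if 0 ≤ k then 2 * (chi3 k * t ^ k * q ^ (k ^ 2)) else 0 := fun k => by
    unfold chiCoeff
    split_ifs <;> ring
  have h4 : HasSum (fun n : ℕ => 2 * term2 t q n) (2 * Theta2 t q) :=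
    (summable_term2 t hq).hasSum.mul_left 2
  have h5 : HasSum (fun k : ℤ => if 0 ≤ k then 2 * (chi3 k * t ^ k * q ^ (k ^ 2)) else 0)
      (2 * Theta2 t q + 0) := by
    refine HasSum.of_nat_of_neg_add_one (h4.congr_fun fun n => ?_) ?_
    · rw [if_pos (by positivity), term2]
      norm_cast
    · refine hasSum_zero.congr_fun fun n => ?_
      rw [if_neg (by omega)]
  rw [thetaSeries, thetaSeries, ← h1.tsum_add h2, tsum_congr h3, h5.tsum_eq, add_zero]

theorem gapSum_three_eq {t q : ℂ} (ht : t ≠ 0) (hq0 : q ≠ 0) (hq : ‖q‖ < 1) :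
    gapSum t q 3 = -(qFac (-q ^ 3) (q ^ 3) * theta (-t ^ 2 * q ^ 2) (q ^ 6)) +
      gapSum t q 2 * Theta1 t q + gapSumStar t q * Theta2 t q := by
  have h1 := two_mul_gapSum_three ht hq0 hq
  have h2 := two_mul_theta ht hq0 hq
  have h3 := two_mul_Theta2 t hq
  have h4 := two_mul_Theta2 (q / t) hq
  rw [← Theta1_eq_Theta2] at h4
  linear_combination (h1 + h2 - gapSum t q 2 * h4 - gapSumStar t q * h3) / 2

/-! ### The case `q = 0` -/

theorem gapSum_zero_right (t : ℂ) (m : ℕ) (hm : 1 ≤ m) : gapSum t 0 m = 1 := by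
  rw [gapSum, tsum_eq_single ⟨∅, by simp [gapSets]⟩, setWeight, Finset.prod_empty]
  rintro ⟨S, hS⟩ hne
  obtain ⟨p, hp⟩ : S.Nonempty := by
    rw [Finset.nonempty_iff_ne_empty]
    rintro rfl
    exact hne rfl
  refine Finset.prod_eq_zero hp ?_
  have := hS.1 p hp
  rw [partWeight, zero_pow (by omega), mul_zero]

theorem qFac_zero_left (q : ℂ) : qFac 0 q = 1 := by
  simp [qFac]

/-- By the convention `0⁻¹ = 0` the theta function takes its limit value. -/
theorem theta_zero_zero : theta 0 0 = 1 := by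
  simp [theta, qFac_zero_left]

theorem Theta2_zero_right (t : ℂ) : Theta2 t 0 = 1 := by
  rw [Theta2, tsum_eq_single 0]
  · simp [term2, chi3_eq]
  · intro k hk
    simp [term2, hk]

/-- At `q = 0` only the empty partition contributes, and both theta quotients equal `1`. -/
theorem product_formulas_zero {t : ℂ} (ht : t ≠ 0) :
    cap 2 t 0 = theta (t * 0 ^ 4) (0 ^ 6) / qFac (0 ^ 3) (0 ^ 3) ∧
    capStar t 0 = theta (t * 0) (0 ^ 6) / qFac (0 ^ 3) (0 ^ 3) ∧
    cap 3 t 0 = -(qFac (-0 ^ 3) (0 ^ 3) * theta (-t ^ 2 * 0 ^ 2) (0 ^ 6)) +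
      cap 2 t 0 * Theta1 t 0 + capStar t 0 * Theta2 t 0 := by
  have h : ∀ m, 1 ≤ m → cap m t 0 = 1 := fun m hm => by
    rw [cap_eq_gapSum ht hm, gapSum_zero_right t m hm]
  have h1 := h 1 le_rfl
  have h2 := h 2 (by norm_num)
  have h3 := h 3 (by norm_num)
  simp [capStar, h1, h2, h3, theta_zero_zero, qFac_zero_left, Theta1_eq_Theta2, Theta2_zero_right]

theorem product_formulas {t q : ℂ} (ht : t ≠ 0) (hq : ‖q‖ < 1) :
    cap 2 t q = theta (t * q ^ 4) (q ^ 6) / qFac (q ^ 3) (q ^ 3) ∧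
    capStar t q = theta (t * q) (q ^ 6) / qFac (q ^ 3) (q ^ 3) ∧
    cap 3 t q = -(qFac (-q ^ 3) (q ^ 3) * theta (-t ^ 2 * q ^ 2) (q ^ 6)) +
      cap 2 t q * Theta1 t q + capStar t q * Theta2 t q := by
  rcases eq_or_ne q 0 with rfl | hq0
  · exact product_formulas_zero ht
  · rw [capStar_eq ht hq, cap_eq_gapSum ht (by norm_num), cap_eq_gapSum ht (by norm_num)]
    exact ⟨gapSum_two_eq ht hq0 hq, gapSumStar_eq ht hq0 hq, gapSum_three_eq ht hq0 hq⟩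

end Capparelli

theorem theorem3p1 (t q : ℂ) (ht : t ≠ 0) (hq : ‖q‖ < 1) :
    (Summable (term1 t q) ∧ Summable (term2 t q)) ∧
    (∀ α ∈ ({0, 1} : Set ℂ), ∀ β ∈ ({0, 1} : Set ℂ),
      Summable (termAB α β t q) ∧
      capAB α β t q =
        (α + β - 1) * qFac (-q ^ 3) (q ^ 3) * theta (-t ^ 2 * q ^ 2) (q ^ 6)
          + theta (t * q ^ 4) (q ^ 6) / qFac (q ^ 3) (q ^ 3)
              * (β + (1 - α - β) * Theta1 t q)
          + theta (t * q) (q ^ 6) / qFac (q ^ 3) (q ^ 3)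
              * (α + (1 - α - β) * Theta2 t q)) ∧
    (cap 1 t q = capAB 1 1 t q ∧ cap 2 t q = capAB 0 1 t q ∧
      capStar t q = capAB 1 0 t q ∧ cap 3 t q = capAB 0 0 t q) ∧
    cap 2 t q = theta (t * q ^ 4) (q ^ 6) / qFac (q ^ 3) (q ^ 3) ∧
    capStar t q = theta (t * q) (q ^ 6) / qFac (q ^ 3) (q ^ 3) ∧
    cap 1 t q =
      qFac (-q ^ 3) (q ^ 3) * theta (-t ^ 2 * q ^ 2) (q ^ 6)
        + cap 2 t q * (1 - Theta1 t q) + capStar t q * (1 - Theta2 t q) ∧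
    cap 3 t q =
      -(qFac (-q ^ 3) (q ^ 3) * theta (-t ^ 2 * q ^ 2) (q ^ 6))
        + cap 2 t q * Theta1 t q + capStar t q * Theta2 t q := by
  obtain ⟨h2, hs, h3⟩ := product_formulas ht hq
  have h1 : cap 1 t q = qFac (-q ^ 3) (q ^ 3) * theta (-t ^ 2 * q ^ 2) (q ^ 6)
      + cap 2 t q * (1 - Theta1 t q) + capStar t q * (1 - Theta2 t q) := by
    have h : capStar t q = cap 1 t q - cap 2 t q + cap 3 t q := rfl
    linear_combination -h - h3
  have hsum1 : Summable (term1 t q) :=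
    (summable_term2 (q / t) hq).congr fun k => (term1_eq_term2 t k).symm
  refine ⟨⟨hsum1, summable_term2 t hq⟩, fun α hα β hβ => ⟨summable_termAB ht hq hα hβ, ?_⟩,
    ⟨(capAB_one_one t q).symm, (capAB_zero_one t q).symm, (capAB_one_zero ht hq).symm,
      (capAB_zero_zero t q).symm⟩, h2, hs, h1, h3⟩
  rw [← h2, ← hs]
  rcases hα with rfl | rfl <;> rcases hβ with rfl | rfl
  · rw [capAB_zero_zero, h3]
    ring
  · rw [capAB_zero_one]
    ring
  · rw [capAB_one_zero ht hq]
    ring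
  · rw [capAB_one_one, h1]
    ring
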